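/- For a finitely generated group $G$, let $S(G)$ be the set of classes $[\varphi]$ of non-zero homomorphisms $\varphi:G\to\mathbb{R}$ modulo multiplication by positive reals. For a subgroup $H\le G$ let $S(G,H)=\{[\varphi]\in S(G)\mid H\subset\ker\varphi\}$, let $S(G,H)^c$ be its complement in $S(G)$, and let $\iota_H^*:S(G,H)^c\to S(H)$ be the restriction map $[\varphi]\mapsto[\varphi|_H]$. The Bieri–Neumann–Strebel invariant $\Sigma(G)\subset S(G)$ is the set of those $[\varphi]$ such that, for some (equivalently, every) finite generating set of $G$, the full subgraph of the Cayley graph (with edges from $g$ to $gs$) spanned by the vertices $g$ with $\varphi(g)\ge 0$ is connected. Let $-\Sigma(G)=\{[-\varphi]\mid[\varphi]\in\Sigma(G)\}$. Let $\varsigma$ be the class of finitely generated groups $H$ with $\Sigma(H)=S(H)$. A rationally defined subsphere of $S(G)$ is the set of classes of non-zero elements of a linear subspace of $\mathrm{Hom}(G,\mathbb{R})$ spanned by homomorphisms with rational values. A $\varsigma$-hierarchy for $G$ is a finite rooted tree whose vertices $\alpha$ carry subgroups $G(\alpha)$ of $G$, the root carrying $G$, such that each vertex $\alpha$ that is not a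 leaf carries a splitting of $G(\alpha)$, over a subgroup $A$ in the class $\varsigma$ (called an edge group), either as an amalgam $G_1*_AG_2$ with $A\ne G_1,G_2$ or as an HNN extension $\langle G_1,t\mid t^{-1}at=\sigma(a),\ a\in A\rangle$ with $A\le G_1$ and $\sigma:A\hookrightarrow G_1$ injective; and $\alpha$ has exactly one descendant for each factor group ($G_1,G_2$, respectively $G_1$), carrying that group. The groups carried by the leaves are called leaf groups. The hierarchy is good if all the groups $G(\alpha)$ are finitely generated and, in every HNN extension occurring in it, both $A$ and $\sigma(A)$ are proper subgroups of $G_1$. **Theorem.** Suppose that the group $G$ admits a good $\varsigma$-hierarchy with edge groups $\{A_i\mid i\in\mathcal I\}$ and leaf groups $\{H_j\mid j\in\mathcal J\}$. Then $$\Sigma(G)=\bigcap_{i\in\mathcal I}S(G,A_i)^c\ \cap\ \bigcap_{j\in\mathcal J}(\iota_{H_j}^*)^{-1}(\Sigma(H_j)).$$ If moreover every leaf group $H_j$ belongs to $\varsigma$, then $\Sigma(G)=\bigcap_{i\in\mathcal I}S(G,A_i)^c$, and this set is the complement of the union of finitely many rationally defined subspheres of $S(G)$; in particular $\Sigma(G)=-\Sigma(G)$,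 and $G$ is not a strictly ascending HNN extension of a finitely generated group, i.e. $G$ cannot be written as $\langle K,t\mid t^{-1}at=\sigma(a),\ a\in K\rangle$ with $K$ finitely generated and $\sigma:K\to K$ injective and not surjective. -/

import Mathlib

open scoped Pointwise

noncomputable section

namespace BNS

universe u

/-- The real vector space `Hom(G, ℝ)`. -/
abbrev Character (G : Type u) [Group G] : Type u := Additive G →+ ℝ

/-- The sphere `S(G)`: classes of non-zero homomorphisms `G → ℝ`, where two of them are identified
when they differ by a positive factor. -/
abbrev CharSphere (G : Type u) [Group G] : Type u := Module.Ray ℝ (Character G)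

section Sphere

variable {G : Type u} [Group G]

/-- The part of the Cayley graph of `G` (edges join `g` to `g * s` for `s ∈ S`) spanned by the
vertices on which `φ` is non-negative. -/
def nonnegCayley (S : Set G) (φ : Character G) :
    SimpleGraph {g : G | 0 ≤ φ (Additive.ofMul g)} :=
  (SimpleGraph.mulCayley S).induce {g : G | 0 ≤ φ (Additive.ofMul g)}

/-- For some finite generating set, the non-negative part of the Cayley graph is connected. -/
def HasConnectedCayley (φ : Character G) : Prop :=
  ∃ S : Finset G, Subgroup.closure (S : Set G) = ⊤ ∧ (nonnegCayley (S : Set G) φ).Connected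

variable (G) in
/-- The Bieri-Neumann-Strebel invariant `Σ(G) ⊆ S(G)`. -/
def Sigma : Set (CharSphere G) :=
  {ξ | ∃ (φ : Character G) (hφ : φ ≠ 0), rayOfNeZero ℝ φ hφ = ξ ∧ HasConnectedCayley φ}

theorem exists_pos_smul_of_ray_eq {φ ψ : Character G} {hφ : φ ≠ 0} {hψ : ψ ≠ 0}
    (h : rayOfNeZero ℝ φ hφ = rayOfNeZero ℝ ψ hψ) : ∃ r : ℝ, 0 < r ∧ ψ = r • φ := by
  obtain ⟨r, hr, h'⟩ := ((ray_eq_iff hφ hψ).1 h).exists_pos_left hφ hψ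
  exact ⟨r, hr, h'.symm⟩

theorem mk_mem_Sigma_iff {φ : Character G} (hφ : φ ≠ 0) :
    rayOfNeZero ℝ φ hφ ∈ Sigma G ↔ HasConnectedCayley φ := by
  refine ⟨?_, fun h => ⟨φ, hφ, rfl, h⟩⟩
  rintro ⟨ψ, hψ, h, S, hS, hc⟩
  obtain ⟨r, hr, rfl⟩ := exists_pos_smul_of_ray_eq h
  refine ⟨S, hS, ?_⟩
  have key : {g : G | 0 ≤ (r • ψ) (Additive.ofMul g)} = {g : G | 0 ≤ ψ (Additive.ofMul g)} := by
    ext g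
    simp [hr]
  unfold nonnegCayley at hc ⊢
  rw [key]
  exact hc

/-- The subsphere `S(G, H)` of the classes `[φ]` with `H ⊆ ker φ`. -/
def subsphere (H : Subgroup G) : Set (CharSphere G) :=
  {ξ | ∃ (φ : Character G) (hφ : φ ≠ 0), rayOfNeZero ℝ φ hφ = ξ ∧
    ∀ h ∈ H, φ (Additive.ofMul h) = 0}

theorem mk_mem_subsphere_iff {H : Subgroup G} {φ : Character G} (hφ : φ ≠ 0) :
    rayOfNeZero ℝ φ hφ ∈ subsphere H ↔ ∀ h ∈ H, φ (Additive.ofMul h) = 0 := by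
  refine ⟨?_, fun h => ⟨φ, hφ, rfl, h⟩⟩
  rintro ⟨ψ, hψ, h, hv⟩ x hx
  obtain ⟨r, -, rfl⟩ := exists_pos_smul_of_ray_eq h
  simp [hv x hx]

/-- Restriction of homomorphisms `G → ℝ` to a subgroup, as a linear map. -/
def res (H : Subgroup G) : Character G →ₗ[ℝ] Character H where
  toFun φ := φ.comp (MonoidHom.toAdditive H.subtype)
  map_add' _ _ := rfl
  map_smul' _ _ := rfl

theorem res_apply (H : Subgroup G) (φ : Character G) (h : H) :
    res H φ (Additive.ofMul h) = φ (Additive.ofMul (h : G)) := rfl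

theorem res_eq_zero_iff (H : Subgroup G) (φ : Character G) :
    res H φ = 0 ↔ ∀ h ∈ H, φ (Additive.ofMul h) = 0 := by
  constructor
  · intro h x hx
    exact DFunLike.congr_fun h (Additive.ofMul (⟨x, hx⟩ : H))
  · intro h
    ext x
    exact h _ (Additive.toMul x).2

theorem res_someVector_ne_zero (H : Subgroup G) (ξ : ↥((subsphere H)ᶜ)) :
    res H (Module.Ray.someVector ξ.1) ≠ 0 := fun h =>
  ξ.2 ⟨_, Module.Ray.someVector_ne_zero ξ.1, Module.Ray.someVector_ray ξ.1,
    (res_eq_zero_iff H _).1 h⟩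

/-- The restriction map `S(G, H)ᶜ → S(H)`, `[φ] ↦ [φ|_H]`
(see `restrict_mk` for independence of the representative). -/
def restrict (H : Subgroup G) (ξ : ↥((subsphere H)ᶜ)) : CharSphere H :=
  rayOfNeZero ℝ (res H (Module.Ray.someVector ξ.1)) (res_someVector_ne_zero H ξ)

theorem restrict_mk (H : Subgroup G) (φ : Character G) (hφ : φ ≠ 0)
    (hξ : rayOfNeZero ℝ φ hφ ∈ (subsphere H)ᶜ) (hr : res H φ ≠ 0) :
    restrict H ⟨rayOfNeZero ℝ φ hφ, hξ⟩ = rayOfNeZero ℝ (res H φ) hr := by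
  unfold restrict
  rw [ray_eq_iff]
  apply SameRay.map
  rw [← ray_eq_iff (Module.Ray.someVector_ne_zero _) hφ]
  exact Module.Ray.someVector_ray _

/-- The preimage of `X ⊆ S(H)` under the restriction map, as a subset of `S(G)`
(contained in `S(G, H)ᶜ`). -/
def restrictPreimage (H : Subgroup G) (X : Set (CharSphere H)) : Set (CharSphere G) :=
  Subtype.val '' (restrict H ⁻¹' X)

/-- A subset of `S(G)` is a rationally defined subsphere if it consists of the classes of the
non-zero elements of a linear subspace of `Hom(G, ℝ)` that is spanned by homomorphisms
with rational values. -/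
def IsRationalSubsphere (X : Set (CharSphere G)) : Prop :=
  ∃ T : Set (Additive G →+ ℚ),
    X = {ξ | ∃ (φ : Character G) (hφ : φ ≠ 0), rayOfNeZero ℝ φ hφ = ξ ∧
      φ ∈ Submodule.span ℝ ((fun ψ : Additive G →+ ℚ =>
        (Rat.castHom ℝ).toAddMonoidHom.comp ψ) '' T)}

end Sphere

/-- The class of finitely generated groups `H` with `Σ(H) = S(H)`. -/
def Varsigma (H : Type u) [Group H] : Prop :=
  Group.FG H ∧ Sigma H = Set.univ

section Splittings

variable {G : Type u} [Group G]

/-- The canonical map `K₀ *_A K₁ → G` for subgroups `A ≤ K₀, K₁` of `G`. -/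
def amalgamMap {K : Fin 2 → Subgroup G} {A : Subgroup G} (hA : ∀ i, A ≤ K i) :
    Monoid.PushoutI (fun i => Subgroup.inclusion (hA i)) →* G :=
  Monoid.PushoutI.lift (fun i => (K i).subtype) A.subtype (fun _ => rfl)

/-- The subgroup `L` of `G` is the amalgamated free product of its subgroups `K 0` and `K 1`
over `A`. -/
def IsAmalgam (L : Subgroup G) (K : Fin 2 → Subgroup G) (A : Subgroup G) : Prop :=
  ∃ hA : ∀ i, A ≤ K i, Function.Injective (amalgamMap hA) ∧ (amalgamMap hA).range = L

/-- The subgroup `L` of `G` is the HNN extension with base group `K`, associated subgroups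
`A, B ≤ K`, isomorphism `σ : A ≃* B` and stable letter `t`, so that `t a t⁻¹ = σ a`
for `a ∈ A`. -/
def IsHNN (L K : Subgroup G) {A B : Subgroup K} (σ : A ≃* B) (t : G) : Prop :=
  ∃ ht : ∀ a : A, t * K.subtype (a : K) = K.subtype (σ a : K) * t,
    Function.Injective (HNNExtension.lift (φ := σ) K.subtype t ht) ∧
    (HNNExtension.lift (φ := σ) K.subtype t ht).range = L

/-- A hierarchy for the subgroup `L` of `G`, with edge groups in the class `P`: a finite rooted
tree carrying `L` at the root. A vertex is a leaf, or carries a non-trivial splitting of its group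
over a group in `P` and has one descendant for each factor, carrying that factor. -/
inductive Hierarchy (P : (H : Type u) → [Group H] → Prop) : Subgroup G → Type u
  | leaf (L : Subgroup G) : Hierarchy P L
  | amalgam (L : Subgroup G) (K : Fin 2 → Subgroup G) (A : Subgroup G)
      (isAmalgam : IsAmalgam L K A) (nontrivial : ∀ i, A ≠ K i) (edge_mem : P A)
      (sub : ∀ i, Hierarchy P (K i)) : Hierarchy P L
  | hnn (L K : Subgroup G) (A B : Subgroup K) (σ : A ≃* B) (t : G)
      (isHNN : IsHNN L K σ t) (edge_mem : P A)
      (sub : Hierarchy P K) : Hierarchy P L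

namespace Hierarchy

variable {P : (H : Type u) → [Group H] → Prop}

/-- The edge groups of a hierarchy, one for each vertex that is not a leaf. -/
def edgeGroups : {L : Subgroup G} → Hierarchy P L → List (Subgroup G)
  | _, leaf _ => []
  | _, amalgam _ _ A _ _ _ sub => A :: ((sub 0).edgeGroups ++ (sub 1).edgeGroups)
  | _, hnn _ K A _ _ _ _ _ sub => A.map K.subtype :: sub.edgeGroups

/-- The groups carried by the leaves of a hierarchy. -/
def leafGroups : {L : Subgroup G} → Hierarchy P L → List (Subgroup G)
  | _, leaf L => [L]
  | _, amalgam _ _ _ _ _ _ sub => (sub 0).leafGroups ++ (sub 1).leafGroups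
  | _, hnn _ _ _ _ _ _ _ _ sub => sub.leafGroups

/-- A hierarchy is good if all the groups carried by its vertices are finitely generated and none
of its splittings is an ascending HNN extension (with either choice of the stable letter `t` or
`t⁻¹`): both associated subgroups of an HNN extension are proper in the base group. -/
def IsGood : {L : Subgroup G} → Hierarchy P L → Prop
  | _, leaf L => L.FG
  | _, amalgam L _ _ _ _ _ sub => L.FG ∧ ∀ i, (sub i).IsGood
  | _, hnn L _ A B _ _ _ _ sub => L.FG ∧ A ≠ ⊤ ∧ B ≠ ⊤ ∧ sub.IsGood

end Hierarchy

end Splittings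

/-- `G` is a strictly ascending HNN extension `⟨K, t | t a t⁻¹ = σ a for a ∈ K⟩` of a finitely
generated subgroup `K`, where `σ` is an isomorphism from `K` to a proper subgroup `B` of `K`. -/
def IsStrictlyAscendingHNN (G : Type u) [Group G] : Prop :=
  ∃ (K : Subgroup G) (A B : Subgroup K) (σ : A ≃* B) (t : G),
    IsHNN ⊤ K σ t ∧ K.FG ∧ A = ⊤ ∧ B ≠ ⊤

end BNS

end

/-!
A class `[φ]` is in `Σ(L)` when the half-spaces `{φ ≥ c}` of a Cayley graph of `L` are connected.
The formula for `Σ(G)` is proved by induction along the hierarchy, for one character `φ` at a time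
(`Hierarchy.connectedOn_iff`), working throughout inside the ambient group (`ConnectedOn`). The
induction step concerns a single splitting of `L` over `A`, where `A` has connected half-spaces
(`IsAmalgam.connectedOn_iff`, `IsHNN.connectedOn_iff`).

* If `φ` is not zero on `A` and the factors have connected half-spaces, so does `L`: move both end
  points of a path far up along a ray in `A`, where each of its letters can be bypassed inside a
  coset of a factor (`connectedOn_of_eventually`).
* If `φ` vanishes on `A` and not on `L`, then `{φ > 0}` contains no end of a letter that crosses the
  edge stabilised by `A` in the Bass-Serre tree, but it meets both sides of this edge, because the
  splitting is not trivial or ascending. So half-spaces of `L` are not connected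
  (`not_connectedOn_of_separation`).
* If `L` has connected half-spaces, a path between two points of a factor can be pushed into the
  factor: each excursion out of it returns in the same coset of the edge group, and can be replaced
  by a path in that coset (`ConnectedOn.of_excursions`).

Of the Bass-Serre tree only this is needed: for each edge there is a function on `L` that changes
exactly when that edge is crossed. It is obtained from the universal property of the splitting, by
letting the factors act on `L × ℤ` over their left translation action on `L`, suitably twisted; no
normal forms are used (`IsAmalgam.exists_crossing`, `IsHNN.exists_primitive`).

If the leaf groups are in `ς`, only the conditions `φ|A ≠ 0` are left. They are symmetric under
`φ ↦ -φ`, and `S(G, A)` is rationally defined because the image of a character is a finitely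
generated free abelian group (`isRationalSubsphere_subsphere`). A strictly ascending HNN extension
has a character that is not in `Σ` while its negative is
(`IsStrictlyAscendingHNN.sigma_ne_neg`).
-/

namespace BNS

/-! ### Connected half-spaces of Cayley graphs -/

section HalfReach

variable {G : Type*} [Group G] {S T : Set G} {φ : Character G} {c d : ℝ} {x y z : G}

/-- An edge of the Cayley graph of `S` (in either direction) between two vertices of the
half-space `{φ ≥ c}`. -/
def HalfStep (S : Set G) (φ : Character G) (c : ℝ) (x y : G) : Prop :=
  c ≤ φ (.ofMul x) ∧ c ≤ φ (.ofMul y) ∧ (x⁻¹ * y ∈ S ∨ y⁻¹ * x ∈ S)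

/-- Two vertices are joined by an edge path of the Cayley graph of `S` inside the half-space
`{φ ≥ c}`. The trivial path is allowed at every vertex, in the half-space or not. -/
abbrev HalfReach (S : Set G) (φ : Character G) (c : ℝ) : G → G → Prop :=
  Relation.ReflTransGen (HalfStep S φ c)

theorem HalfStep.symm (h : HalfStep S φ c x y) : HalfStep S φ c y x :=
  ⟨h.2.1, h.1, h.2.2.symm⟩

theorem HalfReach.symm (h : HalfReach S φ c x y) : HalfReach S φ c y x := by
  induction h with
  | refl => exact .refl
  | tail _ h ih => exact .head h.symm ih

theorem HalfReach.mono (h : HalfReach S φ c x y) (hdc : d ≤ c) (hST : S ⊆ T) :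
    HalfReach T φ d x y :=
  Relation.ReflTransGen.mono (fun _ _ h => ⟨hdc.trans h.1, hdc.trans h.2.1,
    h.2.2.imp (@hST _) (@hST _)⟩) _ _ h

/-- Left translation by `g` carries paths to paths and shifts the level by `φ g`. -/
theorem HalfReach.mul_left (g : G) (h : HalfReach S φ c x y) :
    HalfReach S φ (φ (.ofMul g) + c) (g * x) (g * y) := by
  refine Relation.ReflTransGen.lift (g * ·) (fun a b hab => ?_) _ _ h
  obtain ⟨h1, h2, h3⟩ := hab
  refine ⟨by simpa using h1, by simpa using h2, ?_⟩
  simpa [mul_assoc] using h3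

theorem HalfReach.step_right (s : G) (hs : s ∈ S ∨ s⁻¹ ∈ S) (hx : c ≤ φ (.ofMul x))
    (hxs : c ≤ φ (.ofMul (x * s))) : HalfReach S φ c x (x * s) :=
  .single ⟨hx, hxs, by simpa using hs⟩

theorem HalfReach.mul_pow {a : G} (ha : a ∈ S ∨ a⁻¹ ∈ S) (hpos : 0 ≤ φ (.ofMul a))
    (hx : c ≤ φ (.ofMul x)) (n : ℕ) : HalfReach S φ c x (x * a ^ n) := by
  have key : ∀ n : ℕ, c ≤ φ (.ofMul (x * a ^ n)) := fun n => by
    have : 0 ≤ (n : ℝ) * φ (.ofMul a) := by positivity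
    simp
    linarith
  induction n with
  | zero => simpa using Relation.ReflTransGen.refl
  | succ n ih =>
    refine ih.trans ?_
    have := HalfReach.step_right (x := x * a ^ n) a ha (key n)
      (by simpa [pow_succ, mul_assoc] using key (n + 1))
    simpa [pow_succ, mul_assoc] using this

/-- Every element of the subgroup generated by `S` is reached from `1` at some level. -/
theorem exists_halfReach_one (hx : x ∈ Subgroup.closure S) : ∃ c, HalfReach S φ c 1 x := by
  induction hx using Subgroup.closure_induction with
  | mem s hs =>
    refine ⟨min 0 (φ (.ofMul s)), ?_⟩
    simpa using HalfReach.step_right (φ := φ) (x := 1) (c := min 0 (φ (.ofMul s))) s (.inl hs)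
      (by simp) (by simp)
  | one => exact ⟨0, .refl⟩
  | mul a b _ _ ha hb =>
    obtain ⟨c, hc⟩ := ha
    obtain ⟨d, hd⟩ := hb
    have := hd.mul_left a
    rw [mul_one] at this
    exact ⟨min c (φ (.ofMul a) + d), (hc.mono (min_le_left _ _) subset_rfl).trans
      (this.mono (min_le_right _ _) subset_rfl)⟩
  | inv a _ ha =>
    obtain ⟨c, hc⟩ := ha
    have := hc.mul_left a⁻¹
    rw [mul_one, inv_mul_cancel] at this
    exact ⟨_, this.symm⟩

/-- If `φ` vanishes on `S`, the half-space `{φ ≥ 0}` is the whole Cayley graph. -/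
theorem halfReach_of_eq_zero (h0 : ∀ s ∈ S, φ (.ofMul s) = 0) (hx : x ∈ Subgroup.closure S) :
    φ (.ofMul x) = 0 ∧ HalfReach S φ 0 1 x := by
  induction hx using Subgroup.closure_induction with
  | mem s hs =>
    refine ⟨h0 s hs, ?_⟩
    simpa using HalfReach.step_right (φ := φ) (x := 1) (c := 0) s (.inl hs)
      (by simp) (by simp [h0 s hs])
  | one => exact ⟨by simp, .refl⟩
  | mul a b _ _ ha hb =>
    refine ⟨by simp [ha.1, hb.1], ha.2.trans ?_⟩
    simpa [ha.1] using hb.2.mul_left a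
  | inv a _ ha =>
    refine ⟨by simp [ha.1], ?_⟩
    simpa [ha.1] using (ha.2.mul_left a⁻¹).symm

/-- The half-space `{φ ≥ 0}` of the Cayley graph of the subgroup generated by `S` is connected. -/
def HalfConnected (S : Set G) (φ : Character G) : Prop :=
  ∀ x ∈ Subgroup.closure S, 0 ≤ φ (.ofMul x) → HalfReach S φ 0 1 x

theorem HalfConnected.halfReach (h : HalfConnected S φ) (hx : x ∈ Subgroup.closure S)
    (hy : y ∈ Subgroup.closure S) (hcx : c ≤ φ (.ofMul x)) (hcy : c ≤ φ (.ofMul y)) :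
    HalfReach S φ c x y := by
  wlog hxy : φ (.ofMul x) ≤ φ (.ofMul y) generalizing x y
  · exact (this hy hx hcy hcx (le_of_not_ge hxy)).symm
  have := (h (x⁻¹ * y) (mul_mem (inv_mem hx) hy) (by simpa using hxy)).mul_left x
  simp only [mul_one, add_zero, mul_inv_cancel_left] at this
  exact this.mono hcx subset_rfl

/-- Connectedness of the half-space does not depend on the finite generating set. A path for `S`
becomes a path for `T` at a level lower by a constant, which is made up for by first moving the
end points far up along a letter of `T`. -/
theorem HalfConnected.change (h : HalfConnected S φ) (hS : S.Finite)
    (hST : Subgroup.closure S = Subgroup.closure T) : HalfConnected T φ := by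
  intro x hx hx0
  by_cases hT0 : ∀ s ∈ T, φ (.ofMul s) = 0
  · exact (halfReach_of_eq_zero hT0 hx).2
  push Not at hT0
  obtain ⟨t, ht, hpos⟩ : ∃ t : G, (t ∈ T ∨ t⁻¹ ∈ T) ∧ 0 < φ (.ofMul t) := by
    obtain ⟨t, ht, h0⟩ := hT0
    rcases h0.lt_or_gt with h | h
    · exact ⟨t⁻¹, by simpa using .inr ht, by simpa using h⟩
    · exact ⟨t, .inl ht, h⟩
  obtain ⟨C, hC⟩ : ∃ C, ∀ s ∈ S, HalfReach T φ C 1 s := by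
    have : ∀ s : S, ∃ C, HalfReach T φ C 1 s := fun s =>
      exists_halfReach_one (hST ▸ Subgroup.subset_closure s.2)
    choose f hf using this
    have := hS.to_subtype
    obtain ⟨C, hC⟩ := (Set.finite_range f).bddBelow
    exact ⟨C, fun s hs => (hf ⟨s, hs⟩).mono (hC ⟨_, rfl⟩) subset_rfl⟩
  have translate : ∀ {c : ℝ} {a b : G}, HalfReach S φ c a b → HalfReach T φ (c + C) a b := by
    intro c a b hab
    induction hab with
    | refl => exact .refl
    | @tail b d _ hbd ih =>
      refine ih.trans ?_
      obtain ⟨h1, h2, h3 | h3⟩ := hbd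
      · have := (hC _ h3).mul_left b
        simp only [mul_one, mul_inv_cancel_left] at this
        exact this.mono (by linarith) subset_rfl
      · have := (hC _ h3).mul_left d
        simp only [mul_one, mul_inv_cancel_left] at this
        exact this.symm.mono (by linarith) subset_rfl
  obtain ⟨n, hn⟩ := exists_nat_ge (-C / φ (.ofMul t))
  rw [div_le_iff₀ hpos] at hn
  have htS : t ∈ Subgroup.closure S := by
    rw [hST]
    rcases ht with ht | ht
    · exact Subgroup.subset_closure ht
    · simpa using inv_mem (Subgroup.subset_closure ht)
  have h1 := HalfReach.mul_pow (φ := φ) (x := 1) (c := 0) ht hpos.le (by simp) n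
  have h2 := HalfReach.mul_pow ht hpos.le hx0 n
  have h3 := translate (h.halfReach (c := -C) (x := 1 * t ^ n) (y := x * t ^ n)
    (by simpa using pow_mem htS n) (mul_mem (hST ▸ hx) (pow_mem htS n)) (by simpa using hn)
    (by simp; linarith))
  exact h1.trans ((h3.mono (by simp) subset_rfl).trans h2.symm)

/-- The restriction of `φ` to the subgroup `L` belongs to the Bieri-Neumann-Strebel invariant (or
vanishes): half-spaces of a Cayley graph of `L` for some finite generating set are connected.
Everything takes place inside the ambient group, so that `φ` need not be restricted. -/
def ConnectedOn (φ : Character G) (L : Subgroup G) : Prop :=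
  ∃ S : Set G, S.Finite ∧ Subgroup.closure S = L ∧ HalfConnected S φ

theorem ConnectedOn.halfReach {L : Subgroup G} (h : ConnectedOn φ L) (hT : Subgroup.closure T = L)
    (hx : x ∈ L) (hy : y ∈ L) (hcx : c ≤ φ (.ofMul x)) (hcy : c ≤ φ (.ofMul y)) :
    HalfReach T φ c x y := by
  obtain ⟨S, hS, rfl, hc⟩ := h
  exact (hc.change hS hT.symm).halfReach (hT ▸ hx) (hT ▸ hy) hcx hcy

/-- A version of `ConnectedOn.halfReach` for a coset `z * L` and a set `T` of letters of which only
a subset generates `L`. -/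
theorem ConnectedOn.halfReach_coset {L : Subgroup G} (h : ConnectedOn φ L)
    (hT : Subgroup.closure S = L) (hST : S ⊆ T) (hx : z⁻¹ * x ∈ L) (hy : z⁻¹ * y ∈ L)
    (hcx : c ≤ φ (.ofMul x)) (hcy : c ≤ φ (.ofMul y)) :
    HalfReach T φ c x y := by
  have := (h.halfReach (c := c - φ (.ofMul z)) hT hx hy (by simp; linarith)
    (by simp; linarith)).mul_left z
  simp only [mul_inv_cancel_left] at this
  exact this.mono (by simp) hST

/-- Criterion for connectedness: if `φ a > 0` and each letter `s` is eventually
connected to `1` along the translates of the ray `a, a², a³, …`, at every level, then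
half-spaces are connected. -/
theorem connectedOn_of_eventually (hS : S.Finite) {a : G} (ha : a ∈ S ∨ a⁻¹ ∈ S)
    (hpos : 0 < φ (.ofMul a))
    (h : ∀ s ∈ S, ∀ c : ℝ, ∃ N : ℕ, ∀ n ≥ N, HalfReach S φ c (a ^ n) (s * a ^ n)) :
    ConnectedOn φ (Subgroup.closure S) := by
  refine ⟨S, hS, rfl, fun x hx hx0 => ?_⟩
  have key : ∀ c : ℝ, ∃ N : ℕ, ∀ n ≥ N, HalfReach S φ c (a ^ n) (x * a ^ n) := by
    clear hx0
    induction hx using Subgroup.closure_induction with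
    | mem s hs => exact h s hs
    | one => exact fun c => ⟨0, fun n _ => by simpa using Relation.ReflTransGen.refl⟩
    | mul x y _ _ hx hy =>
      intro c
      obtain ⟨N, hN⟩ := hx c
      obtain ⟨M, hM⟩ := hy (c - φ (.ofMul x))
      refine ⟨max N M, fun n hn => (hN n (le_of_max_le_left hn)).trans ?_⟩
      simpa [mul_assoc] using (hM n (le_of_max_le_right hn)).mul_left x
    | inv x _ hx =>
      intro c
      obtain ⟨N, hN⟩ := hx (c + φ (.ofMul x))
      refine ⟨N, fun n hn => ?_⟩
      simpa using ((hN n hn).mul_left x⁻¹).symm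
  obtain ⟨N, hN⟩ := key 0
  have h1 := HalfReach.mul_pow (φ := φ) (x := 1) (c := 0) ha hpos.le (by simp) N
  rw [one_mul] at h1
  exact h1.trans ((hN N le_rfl).trans (HalfReach.mul_pow ha hpos.le hx0 N).symm)

/-- Connectedness passes to conjugate subgroups. -/
theorem ConnectedOn.conj {L : Subgroup G} (h : ConnectedOn φ L) (t : G) :
    ConnectedOn φ (L.map (MulAut.conj t).toMonoidHom) := by
  obtain ⟨S, hS, rfl, hc⟩ := h
  refine ⟨(MulAut.conj t).toMonoidHom '' S, hS.image _, (MonoidHom.map_closure _ _).symm, ?_⟩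
  rw [HalfConnected, ← MonoidHom.map_closure]
  rintro _ ⟨x, hx, rfl⟩ h0
  have := Relation.ReflTransGen.lift (p := HalfStep ((MulAut.conj t).toMonoidHom '' S) φ 0)
    (MulAut.conj t).toMonoidHom (fun a b hab => ?_) _ _ (hc x hx (by simpa using h0))
  · simpa [Function.onFun] using this
  · obtain ⟨h1, h2, h3⟩ := hab
    refine ⟨by simpa using h1, by simpa using h2, h3.imp (fun h => ⟨_, h, by simp [mul_assoc]⟩)
      (fun h => ⟨_, h, by simp [mul_assoc]⟩)⟩

/-- For an injective `f : H →* G`, the definition of the invariant on `H` through Cayley graphs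
agrees with connectedness on the range of `f` inside `G`. -/
theorem hasConnectedCayley_comp_iff {H : Type*} [Group H] (f : H →* G)
    (hf : Function.Injective f) :
    HasConnectedCayley (φ.comp (MonoidHom.toAdditive f)) ↔ ConnectedOn φ f.range := by
  constructor
  · rintro ⟨S, hS, hc⟩
    have hcl : Subgroup.closure (f '' (S : Set H)) = f.range := by
      rw [← MonoidHom.map_closure, hS, MonoidHom.range_eq_map]
    refine ⟨f '' S, S.finite_toSet.image _, hcl, ?_⟩
    rw [HalfConnected, hcl]
    rintro _ ⟨x, rfl⟩ hx
    obtain ⟨w⟩ := hc.preconnected ⟨1, by simp⟩ ⟨x, by simpa using hx⟩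
    have key : ∀ {a b : {g : H | 0 ≤ (φ.comp (MonoidHom.toAdditive f)) (.ofMul g)}},
        (nonnegCayley (S : Set H) (φ.comp (MonoidHom.toAdditive f))).Walk a b →
        HalfReach (f '' S) φ 0 (f a) (f b) := by
      intro a b w
      induction w with
      | nil => exact .refl
      | @cons a b d hab _ ih =>
        refine .head ⟨by simpa using a.2, by simpa using b.2, ?_⟩ ih
        have hab' : (SimpleGraph.mulCayley (S : Set H)).Adj a b := hab
        rw [SimpleGraph.mulCayley_adj'] at hab'
        obtain ⟨-, s, hs, h | h⟩ := hab'
        · exact .inl ⟨s, hs, by rw [← h]; simp⟩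
        · exact .inr ⟨s, hs, by rw [h]; simp⟩
    simpa using key w
  · rintro ⟨S, hS, hcl, hc⟩
    have hSr : S ⊆ Set.range f := by
      rw [← MonoidHom.coe_range, ← hcl]; exact Subgroup.subset_closure
    have hfin : (f ⁻¹' S).Finite := hS.preimage hf.injOn
    refine ⟨hfin.toFinset, ?_, ?_⟩
    · apply Subgroup.map_injective hf
      rw [MonoidHom.map_closure, Set.Finite.coe_toFinset, Set.image_preimage_eq_of_subset hSr, hcl,
        MonoidHom.range_eq_map]
    · rw [Set.Finite.coe_toFinset]
      have key : ∀ y : G, HalfReach S φ 0 1 y → ∀ x : H, f x = y →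
          ∀ hx : 0 ≤ φ (.ofMul (f x)),
          (nonnegCayley (f ⁻¹' S) (φ.comp (MonoidHom.toAdditive f))).Reachable
            ⟨1, by simp⟩ ⟨x, by simpa using hx⟩ := by
        intro y h
        induction h with
        | refl =>
          intro x hy _
          have : x = 1 := hf (by simpa using hy)
          subst this
          rfl
        | @tail b d hb hbd ih =>
          rintro x rfl hx
          obtain ⟨h1, h2, h3⟩ := hbd
          have : b ∈ f.range := by
            rcases h3 with h3 | h3
            · have := mul_mem (MonoidHom.mem_range.2 ⟨x, rfl⟩) (inv_mem (hSr h3 : _ ∈ f.range))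
              simpa using this
            · have := mul_mem (MonoidHom.mem_range.2 ⟨x, rfl⟩) (hSr h3 : _ ∈ f.range)
              simpa using this
          obtain ⟨z, rfl⟩ := this
          refine (ih z rfl (by simpa using h1)).trans ?_
          by_cases hzx : z = x
          · subst hzx; rfl
          apply SimpleGraph.Adj.reachable
          change (SimpleGraph.mulCayley (f ⁻¹' S)).Adj z x
          rw [SimpleGraph.mulCayley_adj']
          refine ⟨hzx, ?_⟩
          rcases h3 with h3 | h3
          · exact ⟨z⁻¹ * x, by simpa using h3, .inl (by simp)⟩
          · exact ⟨x⁻¹ * z, by simpa using h3, .inr (by simp)⟩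
      have hall : ∀ a : {g : H | 0 ≤ (φ.comp (MonoidHom.toAdditive f)) (.ofMul g)},
          (nonnegCayley (f ⁻¹' S) (φ.comp (MonoidHom.toAdditive f))).Reachable
            ⟨1, by simp⟩ a := by
        rintro ⟨x, hx⟩
        exact key _ (hc _ (hcl ▸ ⟨x, rfl⟩) (by simpa using hx)) x rfl (by simpa using hx)
      exact { preconnected := fun a b => (hall a).symm.trans (hall b)
              nonempty := ⟨⟨1, by simp⟩⟩ }

end HalfReach

/-! ### Edge crossings in splittings -/

section Cocycles

variable {G : Type*} [Group G]

/-- Left translation on the first factor of `G × ℤ`. -/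
def translation : G →* Equiv.Perm (G × ℤ) where
  toFun k := (Equiv.mulLeft k).prodCongr (Equiv.refl ℤ)
  map_one' := by ext <;> simp
  map_mul' a b := by ext <;> simp [mul_assoc]

/-- The permutation of `X × ℤ` that moves the fibre over `x` by `f x`. -/
def fibreShift {X : Type*} (f : X → ℤ) : Equiv.Perm (X × ℤ) where
  toFun p := (p.1, p.2 + f p.1)
  invFun p := (p.1, p.2 - f p.1)
  left_inv p := by simp
  right_inv p := by simp

@[simp]
theorem translation_apply (k : G) (p : G × ℤ) : translation k p = (k * p.1, p.2) := rfl

@[simp]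
theorem translation_symm_apply (k : G) (p : G × ℤ) :
    (translation k).symm p = (k⁻¹ * p.1, p.2) := rfl

@[simp]
theorem fibreShift_apply {X : Type*} (f : X → ℤ) (p : X × ℤ) :
    fibreShift f p = (p.1, p.2 + f p.1) := rfl

@[simp]
theorem fibreShift_symm_apply {X : Type*} (f : X → ℤ) (p : X × ℤ) :
    (fibreShift f).symm p = (p.1, p.2 - f p.1) := rfl

@[simp]
theorem amalgamMap_of {K : Fin 2 → Subgroup G} {A : Subgroup G} (hA : ∀ i, A ≤ K i) (m : Fin 2)
    (k : K m) : amalgamMap hA (.of m k) = k :=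
  Monoid.PushoutI.lift_of (G := fun i => K i) (φ := fun i => Subgroup.inclusion (hA i)) _ _ _ k

@[simp]
theorem amalgamMap_base {K : Fin 2 → Subgroup G} {A : Subgroup G} (hA : ∀ i, A ≤ K i) (a : A) :
    amalgamMap hA (.base _ a) = a :=
  Monoid.PushoutI.lift_base (G := fun i => K i) (φ := fun i => Subgroup.inclusion (hA i)) _ _ _ a

/-- An action on `G × ℤ` over the left translation action on `G` gives a function on `G`, by
following the orbit of `(1, 0)`. The inverse turns left translations into right ones. -/
theorem exists_orbit_height {M : Type*} [Group M] (m : M →* G) (hm : Function.Injective m)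
    (ρ : M →* Equiv.Perm (G × ℤ)) (hρ : ∀ w p, (ρ w p).1 = m w * p.1) :
    ∃ u : G → ℤ, u 1 = 0 ∧ ∀ w, ρ w (1, 0) = (m w, u (m w)⁻¹) := by
  have key : ∀ w, Function.invFun m (m w) = w := Function.leftInverse_invFun hm
  refine ⟨fun g => (ρ (Function.invFun m g⁻¹) (1, 0)).2, ?_, fun w => ?_⟩
  · have := key 1
    simp only [map_one] at this
    simp [this]
  · ext
    · simp [hρ]
    · simp [key]

variable {L : Subgroup G}

theorem indicator_congr {E : Subgroup G} {x y : G} (h : x ∈ E ↔ y ∈ E) :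
    (E : Set G).indicator (1 : G → ℤ) x = (E : Set G).indicator 1 y := by
  by_cases hy : y ∈ E
  · simp [hy, h.2 hy]
  · simp [hy, mt h.1 hy]

/-- The function counting crossings of the edge `A` of the Bass-Serre tree of an amalgam: it does
not change under right multiplication by `K i`, and right multiplication by `K j` changes it as
it changes the indicator function of `A`. It exists because twisting the action of `K j` on
`G × ℤ` by the indicator function of `A` does not affect the action of `A`, so that the universal
property of the amalgam applies. -/
theorem IsAmalgam.exists_crossing {K : Fin 2 → Subgroup G} {A : Subgroup G}
    (h : IsAmalgam L K A) {i j : Fin 2} (hij : i ≠ j) :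
    ∃ u : G → ℤ, u 1 = 0 ∧ (∀ g ∈ L, ∀ k ∈ K i, u (g * k) = u g) ∧
      ∀ g ∈ L, ∀ k ∈ K j, u (g * k) =
        u g - (A : Set G).indicator 1 g + (A : Set G).indicator 1 (g * k) := by
  obtain ⟨hA, hinj, rfl⟩ := h
  let f : G → ℤ := fun g => (A : Set G).indicator 1 g⁻¹
  have hf : ∀ a ∈ A, ∀ g, f (a * g) = f g := by
    intro a ha g
    apply indicator_congr
    rw [mul_inv_rev, Subgroup.mul_mem_cancel_right _ (inv_mem ha)]
  let ρ : Monoid.PushoutI (fun i => Subgroup.inclusion (hA i)) →* Equiv.Perm (G × ℤ) :=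
    Monoid.PushoutI.lift
      (fun m => if m = i then translation.comp (K m).subtype else
        (MulAut.conj (fibreShift f)).toMonoidHom.comp (translation.comp (K m).subtype))
      (translation.comp A.subtype) (by
        intro m
        split_ifs
        · ext <;> simp
        · ext x p
          · simp
          · have := hf x x.2 p.1
            simp [this])
  have hρ_i : ∀ k : K i, ρ (.of i k) = translation (k : G) := by
    intro k; simp [ρ]
  have hρ_j : ∀ k : K j, ρ (.of j k) =
      fibreShift f * translation (k : G) * (fibreShift f)⁻¹ := by
    intro k; simp [ρ, hij.symm]
  have hρ : ∀ w p, (ρ w p).1 = amalgamMap hA w * p.1 := by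
    intro w
    induction w using Monoid.PushoutI.induction_on with
    | of m k =>
      intro p
      simp only [ρ, amalgamMap_of, Monoid.PushoutI.lift_of]
      split_ifs <;> simp
    | base a => intro p; simp [ρ]
    | mul x y hx hy => intro p; simp [hx, hy, mul_assoc]
  obtain ⟨u, hu1, hu⟩ := exists_orbit_height (amalgamMap hA) hinj ρ hρ
  have hof : ∀ m (k : K m), amalgamMap hA (.of m k) = k := by
    exact amalgamMap_of hA
  refine ⟨u, hu1, ?_, ?_⟩
  · intro g hg k hk
    obtain ⟨w, hw⟩ := inv_mem hg
    have := hu (.of i ⟨k⁻¹, inv_mem hk⟩ * w)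
    rw [map_mul, Equiv.Perm.mul_apply, hu w, hρ_i, map_mul, hof, hw] at this
    simpa using (congrArg Prod.snd this).symm
  · intro g hg k hk
    obtain ⟨w, hw⟩ := inv_mem hg
    have := hu (.of j ⟨k⁻¹, inv_mem hk⟩ * w)
    rw [map_mul, Equiv.Perm.mul_apply, hu w, hρ_j, map_mul, hof, hw] at this
    simpa [f] using (congrArg Prod.snd this).symm

/-- For an HNN extension with `t a t⁻¹ = σ a`, every integer valued function `f` on the oriented
edges (the cosets of `A`) of the Bass-Serre tree has a primitive `u` on its vertices (the cosets
of `K`). -/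
theorem IsHNN.exists_primitive {K : Subgroup G} {A B : Subgroup K} {σ : A ≃* B} {t : G}
    (h : IsHNN L K σ t) (f : G → ℤ) (hf : ∀ g, ∀ a ∈ A, f (g * (a : G)) = f g) :
    ∃ u : G → ℤ, u 1 = 0 ∧ (∀ g ∈ L, ∀ k ∈ K, u (g * k) = u g) ∧
      ∀ g ∈ L, u (g * t⁻¹) = u g + f g := by
  obtain ⟨ht, hinj, rfl⟩ := h
  let ρ : HNNExtension K A B σ →* Equiv.Perm (G × ℤ) :=
    HNNExtension.lift (translation.comp K.subtype)
      (translation t * fibreShift (fun g => f g⁻¹)) (by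
        intro a
        ext p
        · simpa [mul_assoc] using congrArg (· * p.1) (ht a)
        · simpa using hf p.1⁻¹ (a⁻¹ : A) (a⁻¹ : A).2)
  have hρ : ∀ w p, (ρ w p).1 = HNNExtension.lift K.subtype t ht w * p.1 := by
    intro w
    induction w using HNNExtension.induction_on with
    | of k => intro p; simp [ρ]
    | t => intro p; simp [ρ]
    | mul x y hx hy => intro p; simp [hx, hy, mul_assoc]
    | inv x hx =>
      intro p
      have := hx ((ρ x)⁻¹ p)
      rw [← Equiv.Perm.mul_apply, mul_inv_cancel, Equiv.Perm.one_apply] at this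
      rw [map_inv, map_inv, this, inv_mul_cancel_left]
  obtain ⟨u, hu1, hu⟩ := exists_orbit_height _ hinj ρ hρ
  refine ⟨u, hu1, ?_, ?_⟩
  · intro g hg k hk
    obtain ⟨w, hw⟩ := inv_mem hg
    have := hu (.of ⟨k⁻¹, inv_mem hk⟩ * w)
    rw [map_mul, Equiv.Perm.mul_apply, hu w, map_mul, hw] at this
    simpa [ρ] using (congrArg Prod.snd this).symm
  · intro g hg
    obtain ⟨w, hw⟩ := inv_mem hg
    have := hu (HNNExtension.t * w)
    rw [map_mul, Equiv.Perm.mul_apply, hu w, map_mul, hw] at this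
    simpa [ρ] using (congrArg Prod.snd this).symm

theorem IsAmalgam.eq_sup {K : Fin 2 → Subgroup G} {A : Subgroup G} (h : IsAmalgam L K A) :
    L = K 0 ⊔ K 1 := by
  obtain ⟨hA, -, rfl⟩ := h
  have hle : ∀ m, K m ≤ K 0 ⊔ K 1 := by
    intro m; fin_cases m
    · exact le_sup_left
    · exact le_sup_right
  apply le_antisymm
  · rintro _ ⟨w, rfl⟩
    induction w using Monoid.PushoutI.induction_on with
    | of m k => simpa using hle m k.2
    | base a => simpa using hle 0 (hA 0 a.2)
    | mul x y hx hy => simpa using mul_mem hx hy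
  · rw [sup_le_iff]
    exact ⟨fun x hx => ⟨.of 0 ⟨x, hx⟩, by simp⟩,
      fun x hx => ⟨.of 1 ⟨x, hx⟩, by simp⟩⟩

theorem IsHNN.eq_sup {K : Subgroup G} {A B : Subgroup K} {σ : A ≃* B} {t : G}
    (h : IsHNN L K σ t) : L = K ⊔ Subgroup.zpowers t := by
  obtain ⟨ht, -, rfl⟩ := h
  apply le_antisymm
  · rintro _ ⟨w, rfl⟩
    induction w using HNNExtension.induction_on with
    | of k => simpa using Subgroup.mem_sup_left k.2
    | t => simpa using Subgroup.mem_sup_right (Subgroup.mem_zpowers t)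
    | mul x y hx hy => simpa using mul_mem hx hy
    | inv x hx => simpa using hx
  · rw [sup_le_iff, Subgroup.zpowers_le]
    exact ⟨fun x hx => ⟨.of ⟨x, hx⟩, by simp⟩, ⟨.t, by simp⟩⟩

end Cocycles

/-! ### Gluing half-spaces, excursions, and separation -/

section Connected

variable {G : Type*} [Group G] {φ : Character G} {L K : Subgroup G}

theorem exists_nat_forall_le {r : ℝ} (hr : 0 < r) (c : ℝ) : ∃ N : ℕ, ∀ n ≥ N, c ≤ n * r := by
  obtain ⟨N, hN⟩ := exists_nat_ge (c / r)
  rw [div_le_iff₀ hr] at hN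
  refine ⟨N, fun n hn => hN.trans ?_⟩
  gcongr

/-- The letters in a subgroup `K` with connected half-spaces satisfy the criterion
`connectedOn_of_eventually` for a ray in `K`. -/
theorem ConnectedOn.eventually {S T : Set G} (h : ConnectedOn φ K) (hT : Subgroup.closure T = K)
    (hTS : T ⊆ S) {a s : G} (ha : a ∈ K) (hs : s ∈ K) (hpos : 0 < φ (.ofMul a)) (c : ℝ) :
    ∃ N : ℕ, ∀ n ≥ N, HalfReach S φ c (a ^ n) (s * a ^ n) := by
  obtain ⟨N, hN⟩ := exists_nat_forall_le hpos (max c (c - φ (.ofMul s)))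
  refine ⟨N, fun n hn => ?_⟩
  have := hN n hn
  rw [max_le_iff] at this
  exact (h.halfReach hT (pow_mem ha n) (mul_mem hs (pow_mem ha n)) (by simpa using this.1)
    (by simp; linarith)).mono le_rfl hTS

theorem exists_pos_of_ne_zero {A : Subgroup G} (h : ∃ a ∈ A, φ (.ofMul a) ≠ 0) :
    ∃ a ∈ A, 0 < φ (.ofMul a) := by
  obtain ⟨a, ha, h0⟩ := h
  rcases h0.lt_or_gt with h | h
  · exact ⟨a⁻¹, inv_mem ha, by simpa using h⟩
  · exact ⟨a, ha, h⟩

/-- If `φ` does not vanish on `K₀ ⊓ K₁`, connectedness on `K₀` and `K₁` gives connectedness on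
the subgroup they generate: a ray in the intersection serves both. -/
theorem ConnectedOn.sup {K₀ K₁ : Subgroup G} (h₀ : ConnectedOn φ K₀) (h₁ : ConnectedOn φ K₁)
    (h : ∃ a ∈ K₀ ⊓ K₁, φ (.ofMul a) ≠ 0) : ConnectedOn φ (K₀ ⊔ K₁) := by
  obtain ⟨a, ha, hpos⟩ := exists_pos_of_ne_zero h
  obtain ⟨S₀, hS₀, hcl₀, -⟩ := id h₀
  obtain ⟨S₁, hS₁, hcl₁, -⟩ := id h₁
  have hcl : Subgroup.closure (insert a (S₀ ∪ S₁)) = K₀ ⊔ K₁ := by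
    rw [Set.insert_eq, Subgroup.closure_union, Subgroup.closure_union, hcl₀, hcl₁, sup_eq_right,
      Subgroup.closure_le]
    simpa using Subgroup.mem_sup_left ha.1
  rw [← hcl]
  refine connectedOn_of_eventually ((hS₀.union hS₁).insert a) (.inl (Set.mem_insert _ _)) hpos ?_
  have hsub₀ : S₀ ⊆ insert a (S₀ ∪ S₁) := fun x hx => .inr (.inl hx)
  have hsub₁ : S₁ ⊆ insert a (S₀ ∪ S₁) := fun x hx => .inr (.inr hx)
  rintro s (rfl | hs | hs)
  · exact h₀.eventually hcl₀ hsub₀ ha.1 ha.1 hpos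
  · exact h₀.eventually hcl₀ hsub₀ ha.1 (hcl₀ ▸ Subgroup.subset_closure hs) hpos
  · exact h₁.eventually hcl₁ hsub₁ ha.2 (hcl₁ ▸ Subgroup.subset_closure hs) hpos

/-- If `a` and `t * a * t⁻¹` lie in `K` and `φ a ≠ 0`, connectedness on `K` gives connectedness on
the subgroup generated by `K` and `t`: the letter `t` joins the rays of `t * a * t⁻¹` and of
`a`. -/
theorem ConnectedOn.sup_zpowers (h : ConnectedOn φ K) (t : G)
    (hA : ∃ a ∈ K ⊓ K.comap (MulAut.conj t).toMonoidHom, φ (.ofMul a) ≠ 0) :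
    ConnectedOn φ (K ⊔ Subgroup.zpowers t) := by
  obtain ⟨a, ha, hpos⟩ := exists_pos_of_ne_zero hA
  obtain ⟨S, hS, hcl, -⟩ := id h
  have haK : a ∈ K := ha.1
  have hbK : t * a * t⁻¹ ∈ K := by simpa using ha.2
  have hcl' : Subgroup.closure (insert t (insert a S)) = K ⊔ Subgroup.zpowers t := by
    have : Subgroup.closure {a} ⊔ K = K := sup_eq_right.2 (by simpa using haK)
    rw [Set.insert_eq, Set.insert_eq, Subgroup.closure_union, Subgroup.closure_union, hcl, this,
      Subgroup.zpowers_eq_closure, sup_comm]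
  rw [← hcl']
  refine connectedOn_of_eventually ((hS.insert a).insert t) (.inl (.inr (.inl rfl))) hpos ?_
  have hsub : S ⊆ insert t (insert a S) := fun x hx => .inr (.inr hx)
  rintro s (rfl | rfl | hs) c
  · obtain ⟨N, hN⟩ := exists_nat_forall_le hpos (max c (c - φ (.ofMul s)))
    refine ⟨N, fun n hn => ?_⟩
    have := hN n hn
    rw [max_le_iff] at this
    have h1 := (h.halfReach (c := c) hcl (pow_mem haK n) (pow_mem hbK n) (by simpa using this.1)
      (by simpa using this.1)).mono le_rfl hsub
    refine h1.trans ?_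
    have h2 := HalfReach.step_right (S := insert s (insert a S)) (φ := φ) (c := c)
      (x := (s * a * s⁻¹) ^ n) s (.inl (.inl rfl)) (by simpa using this.1) (by
        simp; linarith)
    simpa using h2
  · exact h.eventually hcl hsub haK haK hpos c
  · exact h.eventually hcl hsub haK (hcl ▸ Subgroup.subset_closure hs) hpos c

/-- Connectedness passes from `L` to `K ≤ L` when every edge path that leaves `K` through a letter
`s` returns to `K` in the same coset of a subgroup `E ≤ K` which has connected half-spaces itself:
the excursion can then be replaced by a path in that coset. The predicate `y` says that the
excursion, started at `1`, is still going on. -/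
theorem ConnectedOn.of_excursions {S : Set G} (hL : ConnectedOn φ (Subgroup.closure S))
    (hS : S.Finite) (hK : K.FG) (hKL : K ≤ Subgroup.closure S)
    (hex : ∀ s, (s ∈ S ∨ s⁻¹ ∈ S) → s ∉ K → ∃ E ≤ K, ConnectedOn φ E ∧ ∃ y : G → Prop,
      (∀ k ∈ K, ¬ y k) ∧ y s ∧ ∀ g ∈ Subgroup.closure S, ∀ r, (r ∈ S ∨ r⁻¹ ∈ S) →
        y g → ¬ y (g * r) → g * r ∈ E) : ConnectedOn φ K := by
  obtain ⟨U, hU, hUfin⟩ := (Subgroup.fg_iff _).1 hK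
  have : ∀ s : G, ∃ F : Set G, F.Finite ∧ F ⊆ K ∧ ((s ∈ S ∨ s⁻¹ ∈ S) → s ∉ K →
      ConnectedOn φ (Subgroup.closure F) ∧ ∃ y : G → Prop,
      (∀ k ∈ K, ¬ y k) ∧ y s ∧ ∀ g ∈ Subgroup.closure S, ∀ r, (r ∈ S ∨ r⁻¹ ∈ S) →
        y g → ¬ y (g * r) → g * r ∈ Subgroup.closure F) := by
    intro s
    by_cases hs : (s ∈ S ∨ s⁻¹ ∈ S) ∧ s ∉ K
    · obtain ⟨E, hEK, hE, hy⟩ := hex s hs.1 hs.2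
      obtain ⟨F, hF, hcl, -⟩ := id hE
      subst hcl
      exact ⟨F, hF, (Subgroup.closure_le _).1 hEK, fun _ _ => ⟨hE, hy⟩⟩
    · exact ⟨∅, Set.finite_empty, Set.empty_subset _, fun h1 h2 => absurd ⟨h1, h2⟩ hs⟩
  choose F hFfin hFK hF using this
  have hS' : (S ∪ S⁻¹).Finite := hS.union hS.inv
  let T : Set G := U ∪ (S ∩ K) ∪ ⋃ s ∈ S ∪ S⁻¹, F s
  have hTK : T ⊆ K := by
    refine Set.union_subset (Set.union_subset ?_ Set.inter_subset_right)
      (Set.iUnion₂_subset fun s _ => hFK s)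
    rw [← hU]
    exact Subgroup.subset_closure
  have hT : Subgroup.closure T = K := by
    apply le_antisymm ((Subgroup.closure_le _).2 hTK)
    rw [← hU]
    exact Subgroup.closure_mono (fun x hx => .inl (.inl hx))
  refine ⟨T, (hUfin.union (hS.inter_of_left _)).union (hS'.biUnion fun s _ => hFfin s), hT, ?_⟩
  rw [HalfConnected, hT]
  intro x hx hx0
  have hpath := hL.halfReach (c := 0) rfl (one_mem _) (hKL hx) (by simp) hx0
  have key : ∀ g, HalfReach S φ 0 1 g → g ∈ Subgroup.closure S ∧
      ∃ z ∈ K, 0 ≤ φ (.ofMul z) ∧ HalfReach T φ 0 1 z ∧ (g = z ∨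
        ∃ s, (s ∈ S ∨ s⁻¹ ∈ S) ∧ s ∉ K ∧ ConnectedOn φ (Subgroup.closure (F s)) ∧
          ∃ y : G → Prop, (∀ k ∈ K, ¬ y k) ∧ y (z⁻¹ * g) ∧ ∀ g ∈ Subgroup.closure S, ∀ r,
          (r ∈ S ∨ r⁻¹ ∈ S) → y g → ¬ y (g * r) → g * r ∈ Subgroup.closure (F s)) := by
    intro g hg
    induction hg with
    | refl => exact ⟨one_mem _, 1, one_mem _, by simp, .refl, .inl rfl⟩
    | @tail g g' _ hstep ih =>
      obtain ⟨hgL, z, hz, hz0, hzr, hgz⟩ := ih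
      obtain ⟨h1, h2, h3⟩ := hstep
      obtain ⟨r, rfl⟩ : ∃ r, g' = g * r := ⟨g⁻¹ * g', by simp⟩
      have hr : r ∈ S ∨ r⁻¹ ∈ S := by simpa using h3
      have hrL : r ∈ Subgroup.closure S := by
        rcases hr with hr | hr
        · exact Subgroup.subset_closure hr
        · simpa using inv_mem (Subgroup.subset_closure hr)
      refine ⟨mul_mem hgL hrL, ?_⟩
      rcases hgz with rfl | ⟨s, hs, hsK, hFs, y, hyK, hyg, hy⟩
      · by_cases hrK : r ∈ K
        · refine ⟨g * r, mul_mem hz hrK, h2, hzr.trans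
            (HalfReach.step_right r (hr.imp ?_ ?_) h1 h2), .inl rfl⟩
          · exact fun h => .inl (.inr ⟨h, hrK⟩)
          · exact fun h => .inl (.inr ⟨h, inv_mem hrK⟩)
        · obtain ⟨hFs, y, hyK, hyr, hy⟩ := hF r hr hrK
          exact ⟨g, hz, hz0, hzr, .inr ⟨r, hr, hrK, hFs, y, hyK, by simpa using hyr, hy⟩⟩
      · by_cases hgr : y (z⁻¹ * (g * r))
        · exact ⟨z, hz, hz0, hzr, .inr ⟨s, hs, hsK, hFs, y, hyK, hgr, hy⟩⟩
        · -- The excursion ends at `g * r`, in the coset of `F s` in which it started.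
          have hmem := hy (z⁻¹ * g) (mul_mem (inv_mem (hKL hz)) hgL) r hr hyg
            (by rwa [mul_assoc])
          rw [mul_assoc] at hmem
          have hgrK : g * r ∈ K := by
            have := mul_mem hz ((Subgroup.closure_le K).2 (hFK s) hmem)
            simpa using this
          refine ⟨g * r, hgrK, h2, hzr.trans ?_, .inl rfl⟩
          refine hFs.halfReach_coset (z := z) rfl ?_ (by simp) hmem hz0 h2
          exact fun f hf => .inr (Set.mem_biUnion (by simpa using hs) hf)
  obtain ⟨-, z, hz, -, hzr, rfl | ⟨s, -, -, -, y, hyK, hyx, -⟩⟩ := key x hpath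
  · exact hzr
  · exact absurd hyx (hyK _ (mul_mem (inv_mem hz) hx))

/-- A function on `L` which is locally constant on `{φ > 0}`, but takes two different values there,
prevents connectedness. -/
theorem not_connectedOn_of_separation {S : Set G} {α : Type*} (u : G → α)
    (hu : ∀ g ∈ Subgroup.closure S, ∀ s ∈ S, 0 < φ (.ofMul g) → 0 < φ (.ofMul (g * s)) →
      u (g * s) = u g)
    {p q : G} (hp : p ∈ Subgroup.closure S) (hq : q ∈ Subgroup.closure S)
    (hp0 : 0 < φ (.ofMul p)) (hq0 : 0 < φ (.ofMul q)) (hpq : u p ≠ u q) :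
    ¬ ConnectedOn φ (Subgroup.closure S) := by
  intro h
  have hpath := h.halfReach (c := min (φ (.ofMul p)) (φ (.ofMul q))) rfl hp hq (min_le_left _ _)
    (min_le_right _ _)
  have hc : 0 < min (φ (.ofMul p)) (φ (.ofMul q)) := lt_min hp0 hq0
  have key : ∀ g, HalfReach S φ (min (φ (.ofMul p)) (φ (.ofMul q))) p g →
      g ∈ Subgroup.closure S ∧ u g = u p := by
    intro g hg
    induction hg with
    | refl => exact ⟨hp, rfl⟩
    | @tail g g' _ hstep ih =>
      obtain ⟨hgL, hug⟩ := ih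
      obtain ⟨h1, h2, h3 | h3⟩ := hstep
      · have := hu g hgL _ h3 (hc.trans_le h1) (by simpa using hc.trans_le h2)
        have hm := mul_mem hgL (Subgroup.subset_closure h3)
        simp only [mul_inv_cancel_left] at this hm
        exact ⟨hm, this.trans hug⟩
      · have hm := mul_mem hgL (inv_mem (Subgroup.subset_closure h3))
        simp only [mul_inv_rev, inv_inv, mul_inv_cancel_left] at hm
        have := hu g' hm _ h3 (hc.trans_le h2) (by simpa using hc.trans_le h1)
        simp only [mul_inv_cancel_left] at this
        exact ⟨hm, this.symm.trans hug⟩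
  exact hpq (key q hpath).2.symm

end Connected

/-! ### Amalgams and HNN extensions -/

section Splitting

variable {G : Type*} [Group G] {φ : Character G} {L K E : Subgroup G}

theorem exists_ne_zero_of_sup {M N : Subgroup G} (h : ∃ g ∈ M ⊔ N, φ (.ofMul g) ≠ 0) :
    (∃ g ∈ M, φ (.ofMul g) ≠ 0) ∨ ∃ g ∈ N, φ (.ofMul g) ≠ 0 := by
  by_contra! h'
  obtain ⟨g, hg, h0⟩ := h
  have : M ⊔ N ≤ (AddMonoidHom.toMultiplicativeRight φ).ker :=
    sup_le (fun x hx => h'.1 x hx) (fun x hx => h'.2 x hx)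
  exact h0 (this hg)

theorem exists_pos_mul_pow (k : G) {p : G} (hp : 0 < φ (.ofMul p)) :
    ∃ n : ℕ, 0 < φ (.ofMul (k * p ^ n)) := by
  obtain ⟨N, hN⟩ := exists_nat_forall_le hp (1 - φ (.ofMul k))
  refine ⟨N, ?_⟩
  have := hN N le_rfl
  simp
  linarith

theorem IsAmalgam.eq_sup_of_ne {K : Fin 2 → Subgroup G} {A : Subgroup G} (h : IsAmalgam L K A)
    {i j : Fin 2} (hij : i ≠ j) : L = K i ⊔ K j := by
  rw [h.eq_sup]
  fin_cases i <;> fin_cases j <;> first | exact absurd rfl hij | rfl | exact sup_comm _ _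

/-- If `φ` vanished on the edge group of a non-trivial amalgam, paths in `{φ > 0}` could not cross
the edge, although there are elements with `φ > 0` on both of its sides. -/
theorem IsAmalgam.exists_ne_zero {K : Fin 2 → Subgroup G} {A : Subgroup G} (h : IsAmalgam L K A)
    (hne : ∀ i, A ≠ K i) (hL : ∃ g ∈ L, φ (.ofMul g) ≠ 0) (hc : ConnectedOn φ L) :
    ∃ a ∈ A, φ (.ofMul a) ≠ 0 := by
  by_contra! hA
  obtain ⟨i, j, hij, hi⟩ : ∃ i j : Fin 2, i ≠ j ∧ ∃ g ∈ K i, φ (.ofMul g) ≠ 0 := by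
    rw [h.eq_sup] at hL
    rcases exists_ne_zero_of_sup hL with h | h
    · exact ⟨0, 1, by decide, h⟩
    · exact ⟨1, 0, by decide, h⟩
  obtain ⟨u, hu1, hui, huj⟩ := h.exists_crossing hij
  have hcl : Subgroup.closure ((K i : Set G) ∪ K j) = L := by
    rw [Subgroup.closure_union, Subgroup.closure_eq, Subgroup.closure_eq, h.eq_sup_of_ne hij]
  have hiL : K i ≤ L := h.eq_sup_of_ne hij ▸ le_sup_left
  have hjL : K j ≤ L := h.eq_sup_of_ne hij ▸ le_sup_right
  obtain ⟨p, hp, hp0⟩ := exists_pos_of_ne_zero hi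
  obtain ⟨hAK, -⟩ := id h
  obtain ⟨k, hk, hkA⟩ := SetLike.exists_of_lt ((hAK j).lt_of_ne (hne j))
  obtain ⟨n, hn⟩ := exists_pos_mul_pow k hp0
  have hup : u p = 0 := by simpa [hu1] using hui 1 (one_mem _) p hp
  have huk : u k = -1 := by simpa [hu1, hkA] using huj 1 (one_mem _) k hk
  have huq : u (k * p ^ n) = -1 := by rw [hui k (hjL hk) _ (pow_mem hp n), huk]
  rw [← hcl] at hc hiL hjL hui huj
  refine not_connectedOn_of_separation u ?_ (hiL hp) (mul_mem (hjL hk) (pow_mem (hiL hp) n)) hp0 hn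
    (by rw [hup, huq]; decide) hc
  rintro g hg s (hs | hs) h1 h2
  · exact hui g hg s hs
  · have hn : ∀ x, 0 < φ (.ofMul x) → x ∉ A := fun x hx hxA => hx.ne' (hA x hxA)
    rw [huj g hg s hs, Set.indicator_of_notMem (by exact hn _ h1),
      Set.indicator_of_notMem (by exact hn _ h2)]
    simp

/-- Excursions from a factor of an amalgam into the other one begin and end in the same coset of
the edge group. -/
theorem IsAmalgam.connectedOn_factor {K : Fin 2 → Subgroup G} {A : Subgroup G}
    (h : IsAmalgam L K A) (hK : ∀ i, (K i).FG) (hA : ConnectedOn φ A) (hc : ConnectedOn φ L)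
    (i : Fin 2) : ConnectedOn φ (K i) := by
  obtain ⟨j, hij⟩ : ∃ j : Fin 2, i ≠ j := ⟨i + 1, by fin_cases i <;> decide⟩
  obtain ⟨u, hu1, hui, huj⟩ := h.exists_crossing hij
  obtain ⟨S, hS, hSfin⟩ := (Subgroup.fg_iff _).1 (hK i)
  obtain ⟨T, hT, hTfin⟩ := (Subgroup.fg_iff _).1 (hK j)
  have hcl : Subgroup.closure (S ∪ T) = L := by
    rw [Subgroup.closure_union, hS, hT, h.eq_sup_of_ne hij]
  have hletter : ∀ r, (r ∈ S ∪ T ∨ r⁻¹ ∈ S ∪ T) → r ∈ K i ∨ r ∈ K j := by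
    rw [← hS, ← hT]
    rintro r ((hr | hr) | (hr | hr))
    · exact .inl (Subgroup.subset_closure hr)
    · exact .inr (Subgroup.subset_closure hr)
    · exact .inl (by simpa using inv_mem (Subgroup.subset_closure hr))
    · exact .inr (by simpa using inv_mem (Subgroup.subset_closure hr))
  obtain ⟨hAK, -⟩ := id h
  have hu0 : ∀ k ∈ K i, u k = 0 := fun k hk => by simpa [hu1] using hui 1 (one_mem _) k hk
  rw [← hcl] at hc hui huj
  refine hc.of_excursions (hSfin.union hTfin) (hK i)
    (by rw [Subgroup.closure_union, hS]; exact le_sup_left) fun s hs hsK =>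
    ⟨A, hAK i, hA, fun g => u g ≠ 0, fun k hk => not_not.2 (hu0 k hk), ?_,
      fun g hg r hr hg0 hgr => ?_⟩
  · have hsA : s ∉ A := fun h => hsK (hAK i h)
    have := huj 1 (one_mem _) s ((hletter s hs).resolve_left hsK)
    simp [hu1, hsA] at this
    simp [this]
  · rw [not_not] at hgr
    by_contra hgrA
    have hgA : g ∉ A := fun h => hg0 (hu0 g (hAK i h))
    rcases hletter r hr with hr | hr
    · exact hg0 ((hui g hg r hr).symm.trans hgr)
    · have := huj g hg r hr
      simp [hgA, hgrA] at this
      exact hg0 (this.symm.trans hgr)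

theorem IsAmalgam.connectedOn_iff {K : Fin 2 → Subgroup G} {A : Subgroup G}
    (h : IsAmalgam L K A) (hne : ∀ i, A ≠ K i) (hK : ∀ i, (K i).FG) (hA : ConnectedOn φ A)
    (hL : ∃ g ∈ L, φ (.ofMul g) ≠ 0) :
    ConnectedOn φ L ↔ (∃ a ∈ A, φ (.ofMul a) ≠ 0) ∧ ∀ i, ConnectedOn φ (K i) := by
  refine ⟨fun hc => ⟨h.exists_ne_zero hne hL hc, h.connectedOn_factor hK hA hc⟩, ?_⟩
  rintro ⟨⟨a, ha, ha0⟩, hc⟩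
  obtain ⟨hAK, -⟩ := id h
  rw [h.eq_sup]
  exact (hc 0).sup (hc 1) ⟨a, ⟨hAK 0 ha, hAK 1 ha⟩, ha0⟩

/-- `u` counts the crossings of an edge with stabiliser `E`, joining the vertices with stabilisers
`K` and `τ K τ⁻¹`, for the group generated by `K` and `τ`. -/
structure IsCrossing (K E : Subgroup G) (τ : G) (u : G → ℤ) : Prop where
  le : E ≤ K
  one : u 1 = 0
  mul_base : ∀ g ∈ K ⊔ Subgroup.zpowers τ, ∀ k ∈ K, u (g * k) = u g
  mul_letter : ∀ g ∈ K ⊔ Subgroup.zpowers τ, u (g * τ) = u g + (E : Set G).indicator 1 g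

theorem IsCrossing.base {τ : G} {u : G → ℤ} (h : IsCrossing K E τ u) {k : G} (hk : k ∈ K) :
    u k = 0 := by
  simpa [h.one] using h.mul_base 1 (one_mem _) k hk

theorem IsCrossing.letter {τ : G} {u : G → ℤ} (h : IsCrossing K E τ u) : u τ = 1 := by
  simpa [h.one] using h.mul_letter 1 (one_mem _)

/-- If `φ` vanishes on the edge stabiliser `E`, a path in `{φ > 0}` cannot cross the edge. The
hypothesis `hcase` provides elements with `φ > 0` on both of its sides. -/
theorem IsCrossing.not_connectedOn {τ : G} {u : G → ℤ} (h : IsCrossing K E τ u)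
    (hE : ∀ a ∈ E, φ (.ofMul a) = 0)
    (hcase : (∃ k ∈ K, φ (.ofMul k) ≠ 0) ∨
      (E ≠ K ∧ (∀ k ∈ K, φ (.ofMul k) = 0) ∧ 0 < φ (.ofMul τ))) :
    ¬ ConnectedOn φ (K ⊔ Subgroup.zpowers τ) := by
  have hcl : Subgroup.closure ((K : Set G) ∪ {τ}) = K ⊔ Subgroup.zpowers τ := by
    rw [Subgroup.closure_union, Subgroup.closure_eq, Subgroup.zpowers_eq_closure]
  have hKL : K ≤ K ⊔ Subgroup.zpowers τ := le_sup_left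
  have hτL : τ ∈ K ⊔ Subgroup.zpowers τ := Subgroup.mem_sup_right (Subgroup.mem_zpowers τ)
  obtain ⟨p, q, hp, hq, hp0, hq0, hpq⟩ : ∃ p q, p ∈ K ⊔ Subgroup.zpowers τ ∧
      q ∈ K ⊔ Subgroup.zpowers τ ∧ 0 < φ (.ofMul p) ∧ 0 < φ (.ofMul q) ∧ u p ≠ u q := by
    rcases hcase with hK | ⟨hEK, hK, hτ⟩
    · obtain ⟨p, hp, hp0⟩ := exists_pos_of_ne_zero hK
      obtain ⟨n, hn⟩ := exists_pos_mul_pow τ hp0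
      refine ⟨p, τ * p ^ n, hKL hp, mul_mem hτL (pow_mem (hKL hp) n), hp0, hn, ?_⟩
      rw [h.mul_base τ hτL _ (pow_mem hp n), h.base hp, h.letter]
      decide
    · obtain ⟨k, hk, hkE⟩ := SetLike.exists_of_lt (h.le.lt_of_ne hEK)
      refine ⟨τ, k * τ, hτL, mul_mem (hKL hk) hτL, hτ, by simpa [hK k hk] using hτ, ?_⟩
      rw [h.mul_letter k (hKL hk), h.base hk, h.letter, Set.indicator_of_notMem (by exact hkE)]
      decide
  rw [← hcl] at hp hq ⊢
  refine not_connectedOn_of_separation u ?_ hp hq hp0 hq0 hpq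
  rintro g hg s (hs | rfl) h1 h2
  · exact h.mul_base g (hcl ▸ hg) s hs
  · rw [h.mul_letter g (hcl ▸ hg), Set.indicator_of_notMem, add_zero]
    exact fun hgE => h1.ne' (hE g hgE)

/-- An excursion from `K` that starts with the letter `τ` ends in the coset of `E` in which it
started. -/
theorem IsCrossing.mem_of_return {τ : G} {u : G → ℤ} (h : IsCrossing K E τ u) {g r : G}
    (hg : g ∈ K ⊔ Subgroup.zpowers τ) (hr : r ∈ K ∨ r = τ ∨ r = τ⁻¹) (hg0 : u g ≠ 0)
    (hgr : u (g * r) = 0) : g * r ∈ E := by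
  by_contra hgrE
  have hgE : g ∉ E := fun hE => hg0 (h.base (h.le hE))
  rcases hr with hr | rfl | rfl
  · exact hg0 ((h.mul_base g hg r hr).symm.trans hgr)
  · have := h.mul_letter g hg
    simp [hgE] at this
    exact hg0 (this.symm.trans hgr)
  · have := h.mul_letter (g * τ⁻¹)
      (mul_mem hg (inv_mem (Subgroup.mem_sup_right (Subgroup.mem_zpowers τ))))
    simp [hgrE] at this
    exact hg0 (this.trans hgr)

section HNN

variable {A B : Subgroup K} {σ : A ≃* B} {t : G}

theorem IsHNN.conj_eq (h : IsHNN L K σ t) (a : A) : t * ((a : K) : G) * t⁻¹ = ((σ a : K) : G) := by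
  obtain ⟨ht, -⟩ := h
  rw [mul_inv_eq_iff_eq_mul]
  exact ht a

theorem IsHNN.map_conj (h : IsHNN L K σ t) :
    (A.map K.subtype).map (MulAut.conj t).toMonoidHom = B.map K.subtype := by
  ext x
  constructor
  · rintro ⟨_, ⟨a, ha, rfl⟩, rfl⟩
    exact ⟨σ ⟨a, ha⟩, (σ ⟨a, ha⟩).2, by simpa using (h.conj_eq ⟨a, ha⟩).symm⟩
  · rintro ⟨b, hb, rfl⟩
    refine ⟨_, ⟨σ.symm ⟨b, hb⟩, (σ.symm ⟨b, hb⟩).2, rfl⟩, ?_⟩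
    simpa using h.conj_eq (σ.symm ⟨b, hb⟩)

/-- The edge that leaves the base vertex in the direction `t`. -/
theorem IsHNN.exists_isCrossing (h : IsHNN L K σ t) : ∃ u, IsCrossing K (B.map K.subtype) t u := by
  have hmem : ∀ g, ∀ a ∈ A, g * (a : G) * t⁻¹ ∈ B.map K.subtype ↔ g * t⁻¹ ∈ B.map K.subtype := by
    intro g a ha
    have : g * (a : G) * t⁻¹ = g * t⁻¹ * (t * a * t⁻¹) := by group
    rw [this, h.conj_eq ⟨a, ha⟩, Subgroup.mul_mem_cancel_right]
    exact ⟨_, (σ ⟨a, ha⟩).2, rfl⟩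
  obtain ⟨u, hu1, huK, hut⟩ := h.exists_primitive
    (fun g => -((B.map K.subtype : Subgroup G) : Set G).indicator 1 (g * t⁻¹)) (by
      intro g a ha
      exact congrArg Neg.neg (indicator_congr (hmem g a ha)))
  rw [h.eq_sup] at huK hut
  refine ⟨u, Subgroup.map_subtype_le B, hu1, huK, fun g hg => ?_⟩
  have := hut (g * t) (mul_mem hg (Subgroup.mem_sup_right (Subgroup.mem_zpowers t)))
  rw [mul_inv_cancel_right] at this
  omega

/-- The edge that leaves the base vertex in the direction `t⁻¹`. -/
theorem IsHNN.exists_isCrossing_inv (h : IsHNN L K σ t) :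
    ∃ u, IsCrossing K (A.map K.subtype) t⁻¹ u := by
  obtain ⟨u, hu1, huK, hut⟩ := h.exists_primitive
    (((A.map K.subtype : Subgroup G) : Set G).indicator 1) (by
      intro g a ha
      exact indicator_congr (Subgroup.mul_mem_cancel_right _ ⟨a, ha, rfl⟩))
  rw [h.eq_sup, ← Subgroup.zpowers_inv] at huK hut
  exact ⟨u, Subgroup.map_subtype_le A, hu1, huK, hut⟩

theorem map_subtype_ne {A : Subgroup K} (hA : A ≠ ⊤) : A.map K.subtype ≠ K := by
  intro h
  apply hA
  apply Subgroup.map_injective K.subtype_injective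
  rw [h, ← MonoidHom.range_eq_map, Subgroup.range_subtype]

theorem IsHNN.exists_ne_zero (h : IsHNN L K σ t) (hA : A ≠ ⊤) (hB : B ≠ ⊤)
    (hL : ∃ g ∈ L, φ (.ofMul g) ≠ 0) (hc : ConnectedOn φ L) :
    ∃ a ∈ A.map K.subtype, φ (.ofMul a) ≠ 0 := by
  by_contra! hA0
  have hB0 : ∀ b ∈ B.map K.subtype, φ (.ofMul b) = 0 := by
    rw [← h.map_conj]
    rintro _ ⟨a, ha, rfl⟩
    simpa using hA0 a ha
  obtain ⟨u, hu⟩ := h.exists_isCrossing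
  obtain ⟨v, hv⟩ := h.exists_isCrossing_inv
  rw [h.eq_sup] at hL hc
  by_cases hK : ∃ k ∈ K, φ (.ofMul k) ≠ 0
  · exact hu.not_connectedOn hB0 (.inl hK) hc
  · have ht := (exists_ne_zero_of_sup hL).resolve_left hK
    push Not at hK
    obtain ⟨_, ⟨n, rfl⟩, ht⟩ := ht
    have ht : φ (.ofMul t) ≠ 0 := by
      intro h0
      simp [h0] at ht
    rcases ht.lt_or_gt with ht | ht
    · rw [← Subgroup.zpowers_inv] at hc
      exact hv.not_connectedOn hA0 (.inr ⟨map_subtype_ne hA, hK, by simpa using ht⟩) hc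
    · exact hu.not_connectedOn hB0 (.inr ⟨map_subtype_ne hB, hK, ht⟩) hc

theorem IsHNN.connectedOn_base (h : IsHNN L K σ t) (hK : K.FG)
    (hA : ConnectedOn φ (A.map K.subtype)) (hc : ConnectedOn φ L) : ConnectedOn φ K := by
  obtain ⟨S, hS, hSfin⟩ := (Subgroup.fg_iff _).1 hK
  have hB : ConnectedOn φ (B.map K.subtype) := h.map_conj ▸ hA.conj t
  obtain ⟨u, hu⟩ := h.exists_isCrossing
  obtain ⟨v, hv⟩ := h.exists_isCrossing_inv
  have hcl : Subgroup.closure (S ∪ {t}) = K ⊔ Subgroup.zpowers t := by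
    rw [Subgroup.closure_union, hS, Subgroup.zpowers_eq_closure]
  have hletter : ∀ r, (r ∈ S ∪ {t} ∨ r⁻¹ ∈ S ∪ {t}) → r ∈ K ∨ r = t ∨ r = t⁻¹ := by
    rw [← hS]
    rintro r ((hr | hr) | (hr | hr))
    · exact .inl (Subgroup.subset_closure hr)
    · exact .inr (.inl hr)
    · exact .inl (by simpa using inv_mem (Subgroup.subset_closure hr))
    · exact .inr (.inr (by rw [← Set.mem_singleton_iff.1 hr, inv_inv]))
  rw [h.eq_sup, ← hcl] at hc
  refine hc.of_excursions (hSfin.union (Set.finite_singleton t)) hK (hcl ▸ le_sup_left)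
    fun s hs hsK => ?_
  rcases (hletter s hs).resolve_left hsK with rfl | rfl
  · refine ⟨_, hu.le, hB, fun g => u g ≠ 0, fun k hk => not_not.2 (hu.base hk), by simp [hu.letter],
      fun g hg r hr hg0 hgr => hu.mem_of_return (hcl ▸ hg) (hletter r hr) hg0 (not_not.1 hgr)⟩
  · refine ⟨_, hv.le, hA, fun g => v g ≠ 0, fun k hk => not_not.2 (hv.base hk), by simp [hv.letter],
      fun g hg r hr hg0 hgr => hv.mem_of_return ?_ ?_ hg0 (not_not.1 hgr)⟩
    · rwa [Subgroup.zpowers_inv, ← hcl]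
    · rw [inv_inv]
      exact (hletter r hr).imp_right Or.symm

theorem IsHNN.connectedOn_iff (h : IsHNN L K σ t) (hA : A ≠ ⊤) (hB : B ≠ ⊤) (hK : K.FG)
    (hcA : ConnectedOn φ (A.map K.subtype)) (hL : ∃ g ∈ L, φ (.ofMul g) ≠ 0) :
    ConnectedOn φ L ↔ (∃ a ∈ A.map K.subtype, φ (.ofMul a) ≠ 0) ∧ ConnectedOn φ K := by
  refine ⟨fun hc => ⟨h.exists_ne_zero hA hB hL hc, h.connectedOn_base hK hcA hc⟩, ?_⟩
  rintro ⟨⟨a, ha, ha0⟩, hc⟩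
  rw [h.eq_sup]
  refine hc.sup_zpowers t ⟨a, ⟨Subgroup.map_subtype_le A ha, ?_⟩, ha0⟩
  apply Subgroup.map_subtype_le B
  rw [← h.map_conj]
  exact ⟨a, ha, rfl⟩

/-- For an ascending HNN extension, characters vanishing on the base group and negative on the
stable letter are in the invariant: for `s ∈ K`, the element `s * t⁻¹ ^ n` is reached from `t⁻¹ ^ n`
inside the coset `t⁻¹ ^ n * K`, on which the character is constant. -/
theorem connectedOn_of_ascending (hK : K.FG) (ht : ∀ k ∈ K, t * k * t⁻¹ ∈ K)
    (hφK : ∀ k ∈ K, φ (.ofMul k) = 0) (hφt : φ (.ofMul t) < 0) :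
    ConnectedOn φ (K ⊔ Subgroup.zpowers t) := by
  obtain ⟨S, hS, hSfin⟩ := (Subgroup.fg_iff _).1 hK
  have hcl : Subgroup.closure (S ∪ {t}) = K ⊔ Subgroup.zpowers t := by
    rw [Subgroup.closure_union, hS, Subgroup.zpowers_eq_closure]
  have hSK : S ⊆ K := hS ▸ Subgroup.subset_closure
  have hpos : 0 < φ (.ofMul t⁻¹) := by simpa using hφt
  rw [← hcl]
  refine connectedOn_of_eventually (hSfin.union (Set.finite_singleton t)) (a := t⁻¹)
    (.inr (by simp)) hpos ?_
  rintro s (hs | rfl) c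
  · obtain ⟨N, hN⟩ := exists_nat_forall_le hpos c
    refine ⟨N, fun n hn => ?_⟩
    have hpow : ∀ n : ℕ, t ^ n * s * (t ^ n)⁻¹ ∈ K := by
      intro n
      induction n with
      | zero => simpa using hSK hs
      | succ n ih =>
        have := ht _ ih
        simpa [pow_succ', mul_assoc] using this
    have h1 := (halfReach_of_eq_zero (φ := φ) (fun x hx => hφK x (hSK hx)) (hS ▸ hpow n)).2
    have h2 := (h1.mul_left (t⁻¹ ^ n)).mono (d := c) (T := S ∪ {t})
      (by simpa using hN n hn) Set.subset_union_left
    simpa [mul_assoc] using h2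
  · obtain ⟨N, hN⟩ := exists_nat_forall_le hpos (max c (c - φ (.ofMul s)))
    refine ⟨N, fun n hn => ?_⟩
    have := hN n hn
    rw [max_le_iff] at this
    have hcomm : s * s⁻¹ ^ n = s⁻¹ ^ n * s := ((Commute.refl s).inv_right.pow_right n).eq
    rw [hcomm]
    refine HalfReach.step_right s (.inl (.inr rfl)) (by simpa using this.1) ?_
    have := this.2
    simp at this ⊢
    linarith

/-- The homomorphism from an HNN extension to `ℝ` that sends the stable letter to `1` and
vanishes on the base group. -/
theorem IsHNN.exists_character (h : IsHNN ⊤ K σ t) :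
    ∃ χ : Character G, χ (.ofMul t) = 1 ∧ ∀ k ∈ K, χ (.ofMul k) = 0 := by
  obtain ⟨ht, hinj, hrange⟩ := h
  let e := MulEquiv.ofBijective (HNNExtension.lift K.subtype t ht)
    ⟨hinj, MonoidHom.range_eq_top.1 hrange⟩
  let ψ : HNNExtension K A B σ →* Multiplicative ℝ :=
    HNNExtension.lift 1 (.ofAdd 1) (by simp)
  have het : e.symm t = .t := by
    rw [MulEquiv.symm_apply_eq]
    exact (HNNExtension.lift_t _ _ ht).symm
  have hek : ∀ k : K, e.symm k = .of k := by
    intro k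
    rw [MulEquiv.symm_apply_eq]
    exact (HNNExtension.lift_of _ _ ht k).symm
  refine ⟨MonoidHom.toAdditiveLeft (ψ.comp e.symm.toMonoidHom), ?_, fun k hk => ?_⟩
  · simp [het, ψ]
  · have := hek ⟨k, hk⟩
    simp only at this
    simp [this, ψ]

end HNN

end Splitting

/-! ### Hierarchies and subspheres -/

universe u

section Main

variable {G : Type u} [Group G] {φ : Character G}

/-- On groups in the class `ς` half-spaces are connected for every character, including `0`. -/
theorem connectedOn_range_of_varsigma {H : Type u} [Group H] (hH : Varsigma H) (f : H →* G)
    (hf : Function.Injective f) : ConnectedOn φ f.range := by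
  by_cases h0 : φ.comp (MonoidHom.toAdditive f) = 0
  · obtain ⟨S, hS⟩ := (Group.fg_def.1 hH.1)
    have hcl : Subgroup.closure (f '' (S : Set H)) = f.range := by
      rw [← MonoidHom.map_closure, hS, MonoidHom.range_eq_map]
    refine ⟨_, S.finite_toSet.image f, hcl, fun x hx _ => (halfReach_of_eq_zero ?_ hx).2⟩
    rintro _ ⟨s, -, rfl⟩
    exact DFunLike.congr_fun h0 (.ofMul s)
  · rw [← hasConnectedCayley_comp_iff f hf, ← mk_mem_Sigma_iff h0, hH.2]
    trivial

theorem connectedOn_of_varsigma {H : Subgroup G} (hH : Varsigma H) : ConnectedOn φ H := by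
  simpa using connectedOn_range_of_varsigma (φ := φ) hH H.subtype H.subtype_injective

theorem connectedOn_map_of_varsigma {K : Subgroup G} {A : Subgroup K} (hA : Varsigma A) :
    ConnectedOn φ (A.map K.subtype) := by
  have := connectedOn_range_of_varsigma (φ := φ) hA (K.subtype.comp A.subtype)
    (K.subtype_injective.comp A.subtype_injective)
  rwa [MonoidHom.range_comp, Subgroup.range_subtype] at this

namespace Hierarchy

theorem IsGood.fg {P : (H : Type u) → [Group H] → Prop} {L : Subgroup G} {h : Hierarchy P L}
    (hg : h.IsGood) : L.FG := by
  cases h with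
  | leaf => exact hg
  | amalgam => exact hg.1
  | hnn => exact hg.1

/-- The theorem for a single character: connectedness is decided at the edge groups and the leaf
groups. -/
theorem connectedOn_iff {L : Subgroup G} (h : Hierarchy Varsigma L) (hg : h.IsGood)
    (hL : ∃ g ∈ L, φ (.ofMul g) ≠ 0) :
    ConnectedOn φ L ↔ (∀ A ∈ h.edgeGroups, ∃ a ∈ A, φ (.ofMul a) ≠ 0) ∧
      ∀ H ∈ h.leafGroups, (∃ a ∈ H, φ (.ofMul a) ≠ 0) ∧ ConnectedOn φ H := by
  induction h with
  | leaf => simpa [edgeGroups, leafGroups] using fun _ => hL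
  | amalgam L K A hs hne hA sub ih =>
    rw [hs.connectedOn_iff hne (fun i => (hg.2 i).fg) (connectedOn_of_varsigma hA) hL]
    simp only [edgeGroups, leafGroups, List.mem_cons, List.mem_append, or_imp, forall_eq,
      forall_and, and_assoc]
    refine and_congr_right fun hA0 => ?_
    obtain ⟨hAK, -⟩ := id hs
    have hK : ∀ i, ∃ g ∈ K i, φ (.ofMul g) ≠ 0 := fun i =>
      hA0.imp fun a ha => ⟨hAK i ha.1, ha.2⟩
    rw [Fin.forall_fin_two, ih 0 (hg.2 0) (hK 0), ih 1 (hg.2 1) (hK 1)]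
    simp only [forall_and]
    tauto
  | hnn L K A B σ t hs hA sub ih =>
    rw [hs.connectedOn_iff hg.2.1 hg.2.2.1 hg.2.2.2.fg (connectedOn_map_of_varsigma hA) hL]
    simp only [edgeGroups, leafGroups, List.mem_cons, forall_eq_or_imp, and_assoc]
    refine and_congr_right fun hA0 => ?_
    exact ih hg.2.2.2 (hA0.imp fun a ha => ⟨Subgroup.map_subtype_le A ha.1, ha.2⟩)

/-- A leaf group contains the edge group of the vertex above it, if there is one. -/
theorem exists_ne_zero_of_mem_leafGroups {P : (H : Type u) → [Group H] → Prop} {L : Subgroup G}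
    (h : Hierarchy P L) (hL : ∃ g ∈ L, φ (.ofMul g) ≠ 0)
    (hE : ∀ A ∈ h.edgeGroups, ∃ a ∈ A, φ (.ofMul a) ≠ 0) :
    ∀ H ∈ h.leafGroups, ∃ a ∈ H, φ (.ofMul a) ≠ 0 := by
  induction h with
  | leaf => simpa [leafGroups] using hL
  | amalgam L K A hs hne hA sub ih =>
    simp only [edgeGroups, leafGroups, List.mem_cons, List.mem_append, forall_eq_or_imp] at hE ⊢
    obtain ⟨hAK, -⟩ := id hs
    have hK : ∀ i, ∃ g ∈ K i, φ (.ofMul g) ≠ 0 := fun i =>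
      hE.1.imp fun a ha => ⟨hAK i ha.1, ha.2⟩
    rintro H (hH | hH)
    · exact ih 0 (hK 0) (fun B hB => hE.2 B (.inl hB)) H hH
    · exact ih 1 (hK 1) (fun B hB => hE.2 B (.inr hB)) H hH
  | hnn L K A B σ t hs hA sub ih =>
    simp only [edgeGroups, leafGroups, List.mem_cons, forall_eq_or_imp] at hE ⊢
    exact ih (hE.1.imp fun a ha => ⟨Subgroup.map_subtype_le A ha.1, ha.2⟩) hE.2

end Hierarchy

theorem hasConnectedCayley_iff_top : HasConnectedCayley φ ↔ ConnectedOn φ ⊤ := by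
  have := hasConnectedCayley_comp_iff (φ := φ) (MonoidHom.id G) Function.injective_id
  rwa [MonoidHom.range_eq_top.2 Function.surjective_id] at this

theorem mk_mem_Sigma_iff_top (hφ : φ ≠ 0) :
    rayOfNeZero ℝ φ hφ ∈ Sigma G ↔ ConnectedOn φ ⊤ := by
  rw [mk_mem_Sigma_iff, hasConnectedCayley_iff_top]

theorem mk_mem_subsphere_compl_iff (hφ : φ ≠ 0) (H : Subgroup G) :
    rayOfNeZero ℝ φ hφ ∈ (subsphere H)ᶜ ↔ ∃ a ∈ H, φ (.ofMul a) ≠ 0 := by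
  rw [Set.mem_compl_iff, mk_mem_subsphere_iff]
  push Not
  rfl

theorem mk_mem_restrictPreimage_iff (hφ : φ ≠ 0) (H : Subgroup G) :
    rayOfNeZero ℝ φ hφ ∈ restrictPreimage H (Sigma H) ↔
      (∃ a ∈ H, φ (.ofMul a) ≠ 0) ∧ ConnectedOn φ H := by
  have hconn : HasConnectedCayley (res H φ) ↔ ConnectedOn φ H := by
    have := hasConnectedCayley_comp_iff (φ := φ) H.subtype H.subtype_injective
    rwa [Subgroup.range_subtype] at this
  rw [← mk_mem_subsphere_compl_iff hφ, ← hconn]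
  have key : ∀ hξ : rayOfNeZero ℝ φ hφ ∈ (subsphere H)ᶜ,
      restrict H ⟨_, hξ⟩ ∈ Sigma H ↔ HasConnectedCayley (res H φ) := by
    intro hξ
    have hr : res H φ ≠ 0 := by
      rw [Ne, res_eq_zero_iff, ← mk_mem_subsphere_iff hφ]
      exact hξ
    rw [restrict_mk H φ hφ hξ hr, mk_mem_Sigma_iff]
  constructor
  · rintro ⟨ξ, hξ, h⟩
    obtain ⟨ξ, hξ'⟩ := ξ
    subst h
    exact ⟨hξ', (key hξ').1 hξ⟩
  · rintro ⟨hξ, h⟩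
    exact ⟨⟨_, hξ⟩, (key hξ).2 h, rfl⟩

theorem exists_ne_zero_top (hφ : φ ≠ 0) : ∃ g ∈ (⊤ : Subgroup G), φ (.ofMul g) ≠ 0 := by
  by_contra! h
  exact hφ (AddMonoidHom.ext fun x => h x.toMul trivial)

/-- A character of a finitely generated group is a real combination of rational ones that vanish
on its kernel: its image is a finitely generated torsion free subgroup of `ℝ`, hence free. -/
theorem mem_span_rational (hG : (⊤ : Subgroup G).FG) (A : Subgroup G)
    (hφ : ∀ a ∈ A, φ (.ofMul a) = 0) :
    φ ∈ Submodule.span ℝ ((fun ψ : Additive G →+ ℚ => (Rat.castHom ℝ).toAddMonoidHom.comp ψ) ''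
      {ψ | ∀ a ∈ A, ψ (.ofMul a) = 0}) := by
  have : Group.FG G := Group.fg_def.2 hG
  have : AddGroup.FG φ.range := inferInstance
  have : Module.Finite ℤ φ.range := Module.Finite.iff_addGroup_fg.2 this
  let b := Module.finBasis ℤ φ.range
  let ψ := fun i => ((Int.castAddHom ℚ).comp ((b.coord i).toAddMonoidHom.comp φ.rangeRestrict))
  have hsum : φ = ∑ i, ((b i : φ.range) : ℝ) • (Rat.castHom ℝ).toAddMonoidHom.comp (ψ i) := by
    ext x
    have := congrArg (Subtype.val) (b.sum_repr (φ.rangeRestrict x))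
    rw [AddSubgroup.val_finsetSum] at this
    simp [ψ] at this ⊢
    exact this.symm.trans (Finset.sum_congr rfl fun i _ => mul_comm _ _)
  rw [hsum]
  refine Submodule.sum_mem _ fun i _ =>
    Submodule.smul_mem _ _ (Submodule.subset_span ⟨ψ i, ?_, rfl⟩)
  intro a ha
  have : φ.rangeRestrict (.ofMul a) = 0 := Subtype.ext (hφ a ha)
  simp [ψ, this]

theorem isRationalSubsphere_subsphere (hG : (⊤ : Subgroup G).FG) (A : Subgroup G) :
    IsRationalSubsphere (subsphere A) := by
  refine ⟨{ψ | ∀ a ∈ A, ψ (.ofMul a) = 0}, ?_⟩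
  ext ξ
  refine exists_congr fun φ => exists_congr fun hφ => and_congr_right fun hray =>
    ⟨fun h => mem_span_rational hG A h, fun h a ha => ?_⟩
  clear hray hφ
  induction h using Submodule.span_induction with
  | mem x hx =>
    obtain ⟨ψ, hψ, rfl⟩ := hx
    simp [hψ a ha]
  | zero => rfl
  | add x y _ _ hx hy => simp [hx, hy]
  | smul r x _ hx => simp [hx]

theorem neg_subsphere (A : Subgroup G) : -subsphere A = subsphere A := by
  have : ∀ ξ ∈ subsphere A, -ξ ∈ subsphere A := by
    rintro _ ⟨φ, hφ, rfl, h⟩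
    exact ⟨-φ, neg_ne_zero.2 hφ, (neg_rayOfNeZero ℝ φ hφ).symm, fun a ha => by simp [h a ha]⟩
  ext ξ
  exact ⟨fun h => neg_neg ξ ▸ this _ h, this ξ⟩

/-- For a strictly ascending HNN extension `Σ` is not symmetric: of the two classes of characters
that vanish on the base group, exactly one is in `Σ`. -/
theorem IsStrictlyAscendingHNN.sigma_ne_neg (h : IsStrictlyAscendingHNN G) :
    Sigma G ≠ -Sigma G := by
  obtain ⟨K, A, B, σ, t, hs, hK, rfl, hB⟩ := h
  obtain ⟨χ, hχt, hχK⟩ := hs.exists_character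
  have hχ : χ ≠ 0 := by
    rintro rfl
    simp at hχt
  have hG := hs.eq_sup
  intro hsymm
  have h1 : rayOfNeZero ℝ (-χ) (neg_ne_zero.2 hχ) ∈ Sigma G := by
    rw [mk_mem_Sigma_iff_top, hG]
    refine connectedOn_of_ascending hK (fun k hk => ?_) (fun k hk => by simp [hχK k hk])
      (by simp [hχt])
    have := hs.conj_eq ⟨⟨k, hk⟩, trivial⟩
    rw [this]
    exact SetLike.coe_mem _
  have h2 : rayOfNeZero ℝ χ hχ ∉ Sigma G := by
    obtain ⟨u, hu⟩ := hs.exists_isCrossing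
    rw [mk_mem_Sigma_iff_top, hG]
    exact hu.not_connectedOn (fun b hb => hχK b (hu.le hb))
      (.inr ⟨map_subtype_ne hB, hχK, by simp [hχt]⟩)
  rw [hsymm, Set.mem_neg, neg_rayOfNeZero] at h2
  exact h2 h1

end Main

end BNS

theorem theorem4 {G : Type*} [Group G]
    (h : BNS.Hierarchy BNS.Varsigma (⊤ : Subgroup G)) (hgood : h.IsGood) :
    BNS.Sigma G =
      (⋂ A ∈ h.edgeGroups, (BNS.subsphere A)ᶜ) ∩
        (⋂ H ∈ h.leafGroups, BNS.restrictPreimage H (BNS.Sigma H)) ∧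
    ((∀ H ∈ h.leafGroups, BNS.Varsigma H) →
      BNS.Sigma G = (⋂ A ∈ h.edgeGroups, (BNS.subsphere A)ᶜ) ∧
      (∃ F : Set (Set (BNS.CharSphere G)), F.Finite ∧
        (∀ X ∈ F, BNS.IsRationalSubsphere X) ∧ BNS.Sigma G = (⋃₀ F)ᶜ) ∧
      BNS.Sigma G = -BNS.Sigma G ∧
      ¬ BNS.IsStrictlyAscendingHNN G) := by
  constructor
  · ext ξ
    induction ξ using Module.Ray.ind with
    | h φ hφ =>
      simp only [Set.mem_inter_iff, Set.mem_iInter, BNS.mk_mem_Sigma_iff_top,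
        BNS.mk_mem_subsphere_compl_iff, BNS.mk_mem_restrictPreimage_iff]
      exact h.connectedOn_iff hgood (BNS.exists_ne_zero_top hφ)
  · intro hleaf
    have hSigma : BNS.Sigma G = ⋂ A ∈ h.edgeGroups, (BNS.subsphere A)ᶜ := by
      ext ξ
      induction ξ using Module.Ray.ind with
      | h φ hφ =>
        simp only [Set.mem_iInter, BNS.mk_mem_Sigma_iff_top, BNS.mk_mem_subsphere_compl_iff]
        rw [h.connectedOn_iff hgood (BNS.exists_ne_zero_top hφ)]
        refine ⟨And.left, fun hE => ⟨hE, fun H hH =>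
          ⟨?_, BNS.connectedOn_of_varsigma (hleaf H hH)⟩⟩⟩
        exact h.exists_ne_zero_of_mem_leafGroups (BNS.exists_ne_zero_top hφ) hE H hH
    have hneg : BNS.Sigma G = -BNS.Sigma G := by
      rw [hSigma]
      ext ξ
      simp only [Set.mem_neg, Set.mem_iInter, Set.mem_compl_iff]
      refine forall₂_congr fun A _ => not_congr ?_
      rw [← Set.mem_neg, BNS.neg_subsphere]
    refine ⟨hSigma, ⟨BNS.subsphere '' {A | A ∈ h.edgeGroups},
      (List.finite_toSet h.edgeGroups).image _, ?_, ?_⟩, hneg, fun hasc => hasc.sigma_ne_neg hneg⟩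
    · rintro _ ⟨A, -, rfl⟩
      exact BNS.isRationalSubsphere_subsphere hgood.fg A
    · rw [hSigma]
      ext ξ
      simp
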